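/- **Setting.** Let $d\ge 1$, $\mathcal B_1=\{\theta\in\mathbb R^d:\|\theta\|_1\le 1\}$, and let $(\mathcal F_t)_{t\ge 0}$ be a filtration on a probability space; write $\mathbb E_{t-1}=\mathbb E[\,\cdot\,|\mathcal F_{t-1}]$. Let $(\ell_t)_{t\ge1}$ be random convex functions $\mathbb R^d\to\mathbb R$ with (measurably chosen) subgradients $\nabla\ell_t$, both $\mathcal F_t$-measurable, with $\ell_t(\theta)$ integrable for $\theta\in\mathcal B_1$. Assume: (A1) for some $G$, almost surely $\|\nabla\ell_t(\theta)\|_\infty\le G$ for all $t\ge1$, $\theta\in\mathcal B_1$; (A2) for some $\alpha>0$, $\beta\in[0,1]$, for all $t\ge1$ and $\theta_1,\theta_2\in\mathcal B_1$, almost surely $$\mathbb E_{t-1}[\ell_t(\theta_1)-\ell_t(\theta_2)]\le \mathbb E_{t-1}[\nabla\ell_t(\theta_1)^\top(\theta_1-\theta_2)]-\mathbb E_{t-1}\Big[\big(\alpha(\nabla\ell_t(\theta_1)^\top(\theta_1-\theta_2))^2\big)^{1/\beta}\Big],$$ where for $\beta=0$ we read $u^{1/\beta}$ as $0$ if $u\le1$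 and $+\infty$ if $u>1$ (so that (A2) then requires $\alpha(\nabla\ell_t(\theta_1)^\top(\theta_1-\theta_2))^2\le1$ almost surely). **Algorithm.** Given a horizon $T\ge1$, a finite grid $\Theta_0=\{\theta_1,\dots,\theta_K\}\subset\mathcal B_1$, $E>0$ and prior weights $\hat\pi_{k,0}$, put $\eta_i=(e^iE)^{-1}$ for integers $1\le i\le\log(ET)$. In round $t=1,\dots,T$ predict $\hat\theta_{t-1}=\sum_k\hat\pi_{k,t-1}\theta_k$, observe $\nabla\ell_t(\hat\theta_{t-1})$, and set $$\hat\pi_{k,t}=\frac{\sum_i\eta_i\exp\big(\eta_i\sum_{s\le t}(r_{k,s}-\eta_ir_{k,s}^2)\big)\hat\pi_{k,0}}{\sum_{j}\sum_{i}\eta_i\exp\big(\eta_i\sum_{s\le t}(r_{j,s}-\eta_ir_{j,s}^2)\big)\hat\pi_{j,0}},\qquad r_{k,s}=\nabla\ell_s(\hat\theta_{s-1})^\top(\hat\theta_{s-1}-\theta_k).$$ For $\theta\in\mathcal B_1$ let $R_T(\theta)=\frac1T\sum_{t=1}^T\mathbb E_{t-1}[\ell_t(\hat\theta_{t-1})]-\frac1T\sum_{t=1}^T\mathbb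 E_{t-1}[\ell_t(\theta)]$, where $\theta\mapsto\mathbb E_{t-1}[\ell_t(\theta)]$ is any version that is almost surely continuous on $\mathcal B_1$ (such versions exist). For $\theta,\theta'\in\mathcal B_1$ let $D(\theta,\theta')=\min\{0\le\pi\le1:\|\theta-(1-\pi)\theta'\|_1\le\pi\}$ and $D(\theta,\Theta_0)=\min_{\theta'\in\Theta_0}D(\theta,\theta')$. **Theorem 2.** There is a universal constant $C>0$ such that the following holds. Let $x>0$, let $\Theta_0\subset\mathcal B_1$ be finite and contain the $2d$ signed corners $\{\theta:\|\theta\|_1=1,\|\theta\|_0=1\}$ of the $\ell_1$-ball, and assume (A1), (A2), $E=8G/3\ge1$ and $GT\ge e$. Then the algorithm run with $\Theta_0$, the uniform prior $\hat\pi_{k,0}=1/K$ and $E=8G/3$ satisfies, with probability at least $1-e^{-x}$, simultaneously for all $\theta\in\mathcal B_1$, $$R_T(\theta)\le C\left(\Big(\frac a{\alpha T}\Big)^{\frac1{2-\beta}}+G\,D(\theta,\Theta_0)\sqrt{\frac aT}+\frac{aG}T\right),\qquad a=\log\mathrm{Card}(\Theta_0)+\log\log(GT)+x.$$ -/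

import Mathlib

open MeasureTheory

noncomputable section

/-- The `ℓ₁`-norm on `ℝ^d`. -/
def l1norm {d : ℕ} (θ : Fin d → ℝ) : ℝ := ∑ i, |θ i|

/-- The number of nonzero coordinates of a vector of `ℝ^d`. -/
def l0norm {d : ℕ} (θ : Fin d → ℝ) : ℕ := (Finset.univ.filter fun i => θ i ≠ 0).card

/-- The closed unit `ℓ₁`-ball of `ℝ^d`. -/
def l1Ball (d : ℕ) : Set (Fin d → ℝ) := {θ | l1norm θ ≤ 1}

/-! ### Averaging accelerability -/

/-- The set of `π ∈ [0,1]` with `‖θ - (1-π) θ'‖₁ ≤ π`. -/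
def accelSet {d : ℕ} (θ θ' : Fin d → ℝ) : Set ℝ :=
  {p | 0 ≤ p ∧ p ≤ 1 ∧ l1norm (θ - (1 - p) • θ') ≤ p}

/-- The averaging accelerability `D(θ,θ')` of two points. -/
def accel {d : ℕ} (θ θ' : Fin d → ℝ) : ℝ := sInf (accelSet θ θ')

/-- On the unit `ℓ₁`-ball the infimum defining `D(θ,θ')` is a minimum. -/
theorem isLeast_accel {d : ℕ} (θ θ' : Fin d → ℝ) (h : θ ∈ l1Ball d) :
    IsLeast (accelSet θ θ') (accel θ θ') := by
  have hc : IsCompact (accelSet θ θ') := by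
    have : accelSet θ θ' = Set.Icc 0 1 ∩ {p | l1norm (θ - (1 - p) • θ') ≤ p} := by
      ext p
      simp [accelSet, and_assoc]
    rw [this]
    refine isCompact_Icc.inter_right (isClosed_le ?_ continuous_id)
    unfold l1norm
    fun_prop
  refine hc.isLeast_sInf ⟨1, zero_le_one, le_rfl, ?_⟩
  simpa [l1Ball] using h

/-- `D(θ,Θ₀) = min_{θ' ∈ Θ₀} D(θ,θ')` for a finite nonempty grid `Θ₀`. -/
def gridAccel {d : ℕ} (θ : Fin d → ℝ) (grid : Finset (Fin d → ℝ)) : ℝ :=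
  ⨅ θ' : {θ' // θ' ∈ grid}, accel θ θ'.1

/-! ### The algorithm: Squint / BOA with several constant learning rates -/

/-- The number of learning rates: the integers `i` with `1 ≤ i ≤ log (E T)`. -/
def numRates (E : ℝ) (T : ℕ) : ℕ := ⌊Real.log (E * T)⌋₊

/-- The learning rate `η_i = (e^i E)⁻¹`. -/
def rate (E : ℝ) (i : ℕ) : ℝ := (Real.exp i * E)⁻¹

/-- The unnormalised weight `∑_i η_i exp(η_i S_{θ,i}) π₀(θ)` of the grid point `θ`, where
`S θ i` stands for the cumulative quantity `∑_s (r_{θ,s} - η_i r_{θ,s}²)`. -/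
def rawWeight {d : ℕ} (E : ℝ) (T : ℕ) (prior : (Fin d → ℝ) → ℝ)
    (S : (Fin d → ℝ) → ℕ → ℝ) (θ : Fin d → ℝ) : ℝ :=
  ∑ i ∈ Finset.Icc 1 (numRates E T), rate E i * Real.exp (rate E i * S θ i) * prior θ

/-- The prediction `∑_k π̂_k θ_k` with the normalised weights. -/
def predict {d : ℕ} (E : ℝ) (T : ℕ) (grid : Finset (Fin d → ℝ)) (prior : (Fin d → ℝ) → ℝ)
    (S : (Fin d → ℝ) → ℕ → ℝ) : Fin d → ℝ :=
  ∑ θ ∈ grid, (rawWeight E T prior S θ / ∑ θ' ∈ grid, rawWeight E T prior S θ') • θ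

/-- The cumulative quantities `S_{θ,i} = ∑_{s=1}^t (r_{θ,s} - η_i r_{θ,s}²)` after `t` rounds,
where `r_{θ,s} = ∇ℓ_s(θ̂_{s-1})ᵀ (θ̂_{s-1} - θ)` and `grad s` is the map `∇ℓ_s`. -/
def squintState {d : ℕ} (E : ℝ) (T : ℕ) (grid : Finset (Fin d → ℝ)) (prior : (Fin d → ℝ) → ℝ)
    (grad : ℕ → (Fin d → ℝ) → (Fin d → ℝ)) : ℕ → (Fin d → ℝ) → ℕ → ℝ
  | 0 => fun _ _ => 0
  | t + 1 => fun θ i =>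
      let S := squintState E T grid prior grad t
      let p := predict E T grid prior S
      let r := grad (t + 1) p ⬝ᵥ (p - θ)
      S θ i + (r - rate E i * r ^ 2)

/-- The point `θ̂_t` computed by the algorithm after `t` rounds: it is the prediction played in
round `t + 1`. At `t = 0` the weights are the normalised prior. -/
def squint {d : ℕ} (E : ℝ) (T : ℕ) (grid : Finset (Fin d → ℝ)) (prior : (Fin d → ℝ) → ℝ)
    (grad : ℕ → (Fin d → ℝ) → (Fin d → ℝ)) (t : ℕ) : Fin d → ℝ :=
  predict E T grid prior (squintState E T grid prior grad t)

/-- The uniform weight vector over a finite grid. -/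
def uniformPrior {d : ℕ} (grid : Finset (Fin d → ℝ)) : (Fin d → ℝ) → ℝ :=
  fun _ => (grid.card : ℝ)⁻¹

/-! ### Random losses and the assumptions -/

/-- Random convex losses `ℓ_t` (`t ≥ 1`) on `ℝ^d` with subgradients `∇ℓ_t(θ) = g t ω θ`, revealed
along the filtration `F` (round `t` is known at time `t`), with integrable values on the unit
`ℓ₁`-ball. -/
structure IsRandomConvexLoss {d : ℕ} {Ω : Type*} {m : MeasurableSpace Ω} (μ : Measure Ω)
    (F : Filtration ℕ m) (ℓ : ℕ → Ω → (Fin d → ℝ) → ℝ)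
    (g : ℕ → Ω → (Fin d → ℝ) → (Fin d → ℝ)) : Prop where
  convex : ∀ t, 1 ≤ t → ∀ ω, ConvexOn ℝ Set.univ (ℓ t ω)
  subgradient : ∀ t, 1 ≤ t → ∀ ω θ θ', ℓ t ω θ + g t ω θ ⬝ᵥ (θ' - θ) ≤ ℓ t ω θ'
  measurable_loss : ∀ t, 1 ≤ t → ∀ θ, Measurable[F t] fun ω => ℓ t ω θ
  measurable_grad : ∀ t, 1 ≤ t →
    Measurable[(F t).prod MeasurableSpace.pi] fun q : Ω × (Fin d → ℝ) => g t q.1 q.2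
  integrable : ∀ t, 1 ≤ t → ∀ θ ∈ l1Ball d, Integrable (fun ω => ℓ t ω θ) μ

/-- Lipschitz losses: the subgradients on the unit `ℓ₁`-ball are bounded by `G` in sup-norm. -/
def LipschitzLoss {d : ℕ} {Ω : Type*} {m : MeasurableSpace Ω} (μ : Measure Ω)
    (g : ℕ → Ω → (Fin d → ℝ) → (Fin d → ℝ)) (G : ℝ) : Prop :=
  ∀ᵐ ω ∂μ, ∀ t, 1 ≤ t → ∀ θ ∈ l1Ball d, ∀ i, |g t ω θ i| ≤ G

/-- `u ^ (1/β)` for `u ≥ 0`. For `β = 0` it is the limit as `β → 0⁺`, which is `0` for `u < 1`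
and `+∞` for `u > 1`; the infinite value is excluded separately in `WeakExpConcave`. -/
def powInv (u β : ℝ) : ℝ := if β = 0 then 0 else u ^ (1 / β)

/-- Weak exp-concavity with parameters `α`, `β`: for all `t ≥ 1` and `θ₁, θ₂` in the unit
`ℓ₁`-ball, almost surely, with `s = ∇ℓ_t(θ₁)ᵀ(θ₁ - θ₂)`,
`E_{t-1}[ℓ_t(θ₁) - ℓ_t(θ₂)] ≤ E_{t-1}[s] - E_{t-1}[(α s²)^{1/β}]`.
For `β = 0` this asks for `α s² ≤ 1`, so that the last expectation is finite. -/
def WeakExpConcave {d : ℕ} {Ω : Type*} {m : MeasurableSpace Ω} (μ : Measure Ω)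
    (F : Filtration ℕ m) (ℓ : ℕ → Ω → (Fin d → ℝ) → ℝ)
    (g : ℕ → Ω → (Fin d → ℝ) → (Fin d → ℝ)) (α β : ℝ) : Prop :=
  ∀ t, 1 ≤ t → ∀ θ₁ ∈ l1Ball d, ∀ θ₂ ∈ l1Ball d,
    (β = 0 → ∀ᵐ ω ∂μ, α * (g t ω θ₁ ⬝ᵥ (θ₁ - θ₂)) ^ 2 ≤ 1) ∧
    ∀ᵐ ω ∂μ,
      (μ[fun ω' => ℓ t ω' θ₁ - ℓ t ω' θ₂ | F (t - 1)]) ω ≤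
        (μ[fun ω' => g t ω' θ₁ ⬝ᵥ (θ₁ - θ₂) | F (t - 1)]) ω -
        (μ[fun ω' => powInv (α * (g t ω' θ₁ ⬝ᵥ (θ₁ - θ₂)) ^ 2) β | F (t - 1)]) ω

/-! ### Average risk -/

/-- `L t θ ω` is a regular version of the conditional risks `E_{t-1}[ℓ_t(θ)](ω)`: each `L t θ` is
a version of the conditional expectation, and almost every `θ ↦ L t θ ω` is continuous on the unit
`ℓ₁`-ball. Any two of them agree almost surely for all `θ` in the ball simultaneously. -/
def IsCondRisk {d : ℕ} {Ω : Type*} {m : MeasurableSpace Ω} (μ : Measure Ω)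
    (F : Filtration ℕ m) (ℓ : ℕ → Ω → (Fin d → ℝ) → ℝ)
    (L : ℕ → (Fin d → ℝ) → Ω → ℝ) : Prop :=
  (∀ t, 1 ≤ t → ∀ θ ∈ l1Ball d, L t θ =ᵐ[μ] μ[fun ω => ℓ t ω θ | F (t - 1)]) ∧
  ∀ᵐ ω ∂μ, ∀ t, 1 ≤ t → ContinuousOn (fun θ => L t θ ω) (l1Ball d)

/-- The average risk
`R_T(θ) = (1/T) ∑_{t=1}^T E_{t-1}[ℓ_t(θ̂_{t-1})] - (1/T) ∑_{t=1}^T E_{t-1}[ℓ_t(θ)]` of the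
predictions `pred t ω = θ̂_t`, where `L` is a version of the conditional risks. -/
def avgRisk {d : ℕ} {Ω : Type*} {m : MeasurableSpace Ω} (μ : Measure Ω)
    (F : Filtration ℕ m) (ℓ : ℕ → Ω → (Fin d → ℝ) → ℝ) (pred : ℕ → Ω → (Fin d → ℝ))
    (L : ℕ → (Fin d → ℝ) → Ω → ℝ) (T : ℕ) (θ : Fin d → ℝ) (ω : Ω) : ℝ :=
  1 / (T : ℝ) * ∑ t ∈ Finset.Icc 1 T, (μ[fun ω' => ℓ t ω' (pred (t - 1) ω') | F (t - 1)]) ω -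
    1 / (T : ℝ) * ∑ t ∈ Finset.Icc 1 T, L t θ ω

/-- The complexity term `a = log (Card Θ₀) + log log (G T) + x`. -/
def complexityTerm {d : ℕ} (grid : Finset (Fin d → ℝ)) (G : ℝ) (T : ℕ) (x : ℝ) : ℝ :=
  Real.log grid.card + Real.log (Real.log (G * T)) + x

end

/-!
The potential `∑ π e^{η ∑ (r - η r²)}`, summed over grid points of prior weight `π` and learning
rates `η`, does not increase, because `e^{X - X²} ≤ 1 + X` for small `X` and the prediction makes
the linear terms cancel. Hence `η ∑ (r - η r²)` is at most `log (N / π)` along every path for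
normalised weights, `N` being the number of learning rates. The exponential supermartingale
`exp (∑ (E[X - 4X²] - (X - X²)))` with `X = η r` turns this into a bound on `η ∑ E[r - 4η r²]` that
holds for all grid points and all rates at once.

By Young's inequality `α ρ^{1-β} v ≤ (α v)^{1/β} + ρ`, weak exp-concavity bounds the conditional
regret by `∑ E[r - c r²] + T ρ` whenever `c` is at most a constant times `α ρ^{1-β}`. Write
`θ = (1 - π) k + π ξ` with `k` in the grid, `ξ` in the `ℓ₁`-ball and `π` the acceleration
parameter. The surrogate at `k` is used with a large learning rate `η`, and `ξ`, an average of grid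
points, with a small one; the quadratic term at `θ` pays for the one at `k` up to `η (G π)²`. With
`s² = a / T` and `ρ = (a / (α T))^{1/(2-β)}`, a rate `η` with `1 / η` of order
`ρ / s² + G π / s + G` is small enough for all of this, and the cost `s² / η` is the bound.
-/

/-! ### The `ℓ₁`-norm and the `ℓ₁`-ball -/

section L1

variable {d : ℕ}

lemma l1norm_nonneg (v : Fin d → ℝ) : 0 ≤ l1norm v :=
  Finset.sum_nonneg fun _ _ => abs_nonneg _

lemma eq_zero_of_l1norm_le_zero {v : Fin d → ℝ} (hv : l1norm v ≤ 0) : v = 0 := by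
  have h := (Finset.sum_eq_zero_iff_of_nonneg fun i _ => abs_nonneg (v i)).1
    (hv.antisymm (l1norm_nonneg v))
  exact funext fun i => abs_eq_zero.1 (h i (Finset.mem_univ i))

lemma l1norm_add_le (v w : Fin d → ℝ) : l1norm (v + w) ≤ l1norm v + l1norm w := by
  unfold l1norm
  rw [← Finset.sum_add_distrib]
  exact Finset.sum_le_sum fun i _ => abs_add_le _ _

lemma l1norm_smul (c : ℝ) (v : Fin d → ℝ) : l1norm (c • v) = |c| * l1norm v := by
  simp [l1norm, abs_mul, Finset.mul_sum]

lemma l1norm_neg (v : Fin d → ℝ) : l1norm (-v) = l1norm v := by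
  simp [l1norm]

lemma l1norm_sub_le (v w : Fin d → ℝ) : l1norm (v - w) ≤ l1norm v + l1norm w := by
  rw [sub_eq_add_neg, ← l1norm_neg w]
  exact l1norm_add_le _ _

lemma l1norm_le_mul_norm (v : Fin d → ℝ) : l1norm v ≤ d * ‖v‖ :=
  calc ∑ i, |v i| ≤ ∑ _i : Fin d, ‖v‖ := Finset.sum_le_sum fun i _ => norm_le_pi_norm v i
    _ = d * ‖v‖ := by simp

lemma l1norm_single (i : Fin d) (c : ℝ) : l1norm (Pi.single i c) = |c| := by
  unfold l1norm
  rw [Finset.sum_eq_single i] <;> simp +contextual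

lemma l0norm_single (i : Fin d) {c : ℝ} (hc : c ≠ 0) : l0norm (Pi.single i c) = 1 := by
  unfold l0norm
  rw [Finset.card_eq_one]
  exact ⟨i, by ext j; simp [Pi.single_apply, hc]⟩

lemma zero_mem_l1Ball : (0 : Fin d → ℝ) ∈ l1Ball d := by
  simp [l1Ball, l1norm]

lemma convex_l1Ball : Convex ℝ (l1Ball d) := by
  intro v (hv : l1norm v ≤ 1) w (hw : l1norm w ≤ 1) a b ha hb hab
  calc l1norm (a • v + b • w) ≤ l1norm (a • v) + l1norm (b • w) := l1norm_add_le _ _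
    _ = a * l1norm v + b * l1norm w := by
      rw [l1norm_smul, l1norm_smul, abs_of_nonneg ha, abs_of_nonneg hb]
    _ ≤ a * 1 + b * 1 := by gcongr
    _ = 1 := by linarith

lemma abs_dotProduct_le {G : ℝ} {h : Fin d → ℝ} (hG : ∀ i, |h i| ≤ G) (v : Fin d → ℝ) :
    |h ⬝ᵥ v| ≤ G * l1norm v := by
  unfold l1norm dotProduct
  rw [Finset.mul_sum]
  refine (Finset.abs_sum_le_sum_abs _ _).trans (Finset.sum_le_sum fun i _ => ?_)
  rw [abs_mul]
  exact mul_le_mul_of_nonneg_right (hG i) (abs_nonneg _)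

lemma abs_dotProduct_sub_le {G : ℝ} (hG0 : 0 ≤ G) {h v w : Fin d → ℝ} (hG : ∀ i, |h i| ≤ G)
    (hv : v ∈ l1Ball d) (hw : w ∈ l1Ball d) : |h ⬝ᵥ (v - w)| ≤ 2 * G := by
  have hv1 : l1norm v ≤ 1 := hv
  have hw1 : l1norm w ≤ 1 := hw
  calc |h ⬝ᵥ (v - w)| ≤ G * l1norm (v - w) := abs_dotProduct_le hG _
    _ ≤ G * 2 := by gcongr; linarith [l1norm_sub_le v w]
    _ = 2 * G := mul_comm _ _

lemma single_mem_of_corners_mem {grid : Finset (Fin d → ℝ)}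
    (hgrid : ∀ θ : Fin d → ℝ, l1norm θ = 1 → l0norm θ = 1 → θ ∈ grid) (i : Fin d) {c : ℝ}
    (hc : |c| = 1) : Pi.single i c ∈ grid :=
  hgrid _ ((l1norm_single i c).trans hc) (l0norm_single i (abs_pos.1 (hc ▸ one_pos)))

lemma two_le_card_of_corners_mem (hd : 0 < d) {grid : Finset (Fin d → ℝ)}
    (hgrid : ∀ θ : Fin d → ℝ, l1norm θ = 1 → l0norm θ = 1 → θ ∈ grid) : 2 ≤ grid.card := by
  refine Finset.one_lt_card.2
    ⟨Pi.single ⟨0, hd⟩ 1, single_mem_of_corners_mem hgrid _ (by simp),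
      Pi.single ⟨0, hd⟩ (-1), single_mem_of_corners_mem hgrid _ (by simp), fun h => ?_⟩
  have := congrFun h ⟨0, hd⟩
  norm_num at this

-- `ξ` is the combination of the corners `sign (ξ i) e_i` with weights `|ξ i|`; the missing mass
-- `1 - ‖ξ‖₁` is put at the origin, the midpoint of two opposite corners.
lemma l1Ball_subset_convexHull_of_corners_mem (hd : 0 < d) {grid : Finset (Fin d → ℝ)}
    (hgrid : ∀ θ : Fin d → ℝ, l1norm θ = 1 → l0norm θ = 1 → θ ∈ grid) :
    l1Ball d ⊆ convexHull ℝ (grid : Set (Fin d → ℝ)) := by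
  intro ξ (hξ : l1norm ξ ≤ 1)
  have hconv := convex_convexHull ℝ (grid : Set (Fin d → ℝ))
  have hcorner (i : Fin d) (c : ℝ) (hc : |c| = 1) :
      Pi.single i c ∈ convexHull ℝ (grid : Set (Fin d → ℝ)) :=
    subset_convexHull ℝ (grid : Set (Fin d → ℝ)) (single_mem_of_corners_mem hgrid i hc)
  have hzero : 0 ∈ convexHull ℝ (grid : Set (Fin d → ℝ)) := by
    have h := hconv (hcorner ⟨0, hd⟩ 1 (by simp)) (hcorner ⟨0, hd⟩ (-1) (by simp))
      (a := 1 / 2) (b := 1 / 2) (by norm_num) (by norm_num) (by norm_num)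
    rwa [Pi.single_neg, smul_neg, add_neg_cancel] at h
  let w : Option (Fin d) → ℝ := fun o => o.elim (1 - l1norm ξ) fun i => |ξ i|
  let z : Option (Fin d) → Fin d → ℝ :=
    fun o => o.elim 0 fun i => Pi.single i (if 0 ≤ ξ i then 1 else -1)
  have hsum : ∑ o, w o • z o = ξ := by
    ext k
    rw [Fintype.sum_option, Pi.add_apply, Finset.sum_apply, Finset.sum_eq_single k]
    · by_cases hk : 0 ≤ ξ k
      · simp [w, z, hk, abs_of_nonneg hk]
      · simp [w, z, hk, abs_of_neg (not_le.1 hk)]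
    · intro i _ hik
      simp [z, hik.symm]
    · simp
  rw [← hsum]
  refine hconv.sum_mem (Option.forall.2 ⟨fun _ => sub_nonneg.2 hξ, fun i _ => abs_nonneg _⟩) ?_
    (Option.forall.2 ⟨fun _ => hzero, fun i _ => hcorner i _ (by split_ifs <;> simp)⟩)
  rw [Fintype.sum_option]
  exact sub_add_cancel 1 (l1norm ξ)

lemma exists_eq_gridAccel_combination {grid : Finset (Fin d → ℝ)} (hne : grid.Nonempty)
    {θ : Fin d → ℝ} (hθ : θ ∈ l1Ball d) :
    gridAccel θ grid ∈ Set.Icc (0 : ℝ) 1 ∧ ∃ θ' ∈ grid, ∃ ξ ∈ l1Ball d,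
      θ = (1 - gridAccel θ grid) • θ' + gridAccel θ grid • ξ := by
  have : Nonempty {θ' // θ' ∈ grid} := hne.to_subtype
  obtain ⟨⟨θ', hθ'⟩, hmin⟩ :=
    exists_eq_ciInf_of_finite (f := fun θ' : {θ' // θ' ∈ grid} => accel θ θ'.1)
  have hD : gridAccel θ grid = accel θ θ' := hmin.symm
  rw [hD]
  obtain ⟨h0, h1, hdist⟩ := (isLeast_accel θ θ' hθ).1
  refine ⟨⟨h0, h1⟩, θ', hθ', ?_⟩
  rcases h0.eq_or_lt with hp | hp
  · refine ⟨0, zero_mem_l1Ball, ?_⟩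
    rw [smul_zero, add_zero]
    exact sub_eq_zero.1 (eq_zero_of_l1norm_le_zero (hdist.trans hp.ge))
  · refine ⟨(accel θ θ')⁻¹ • (θ - (1 - accel θ θ') • θ'), ?_, ?_⟩
    · change l1norm _ ≤ 1
      rw [l1norm_smul, abs_of_pos (inv_pos.2 hp), inv_mul_le_iff₀ hp, mul_one]
      exact hdist
    · rw [smul_inv_smul₀ hp.ne', add_sub_cancel]

end L1

/-! ### Scalar inequalities -/

lemma mul_le_powInv_add {α β ρ v : ℝ} (hα : 0 < α) (hβ0 : 0 ≤ β) (hβ1 : β ≤ 1) (hρ : 0 < ρ)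
    (hv : 0 ≤ v) (h : β = 0 → α * v ≤ 1) :
    α * ρ ^ (1 - β) * v ≤ powInv (α * v) β + ρ := by
  unfold powInv
  split_ifs with hβ
  · subst hβ
    rw [sub_zero, Real.rpow_one]
    nlinarith [h rfl]
  · have hav : 0 ≤ α * v := by positivity
    have hz : 0 ≤ (α * v) ^ (1 / β) := Real.rpow_nonneg hav _
    have young : (α * v) * ρ ^ (1 - β) ≤ β * (α * v) ^ (1 / β) + (1 - β) * ρ := by
      simpa [← Real.rpow_mul hav, hβ] using
        Real.geom_mean_le_arith_mean2_weighted hβ0 (sub_nonneg.2 hβ1) hz hρ.le (by ring)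
    nlinarith

lemma mul_rpow_balance {α β c : ℝ} (hα : 0 < α) (hβ : β ≤ 1) (hc : 0 < c) :
    α * ((c / α) ^ (1 / (2 - β))) ^ (1 - β) = c / (c / α) ^ (1 / (2 - β)) := by
  have hy : 0 < c / α := by positivity
  have h2 : 2 - β ≠ 0 := by linarith
  rw [eq_div_iff (Real.rpow_pos_of_pos hy _).ne', mul_assoc, ← Real.rpow_add_one
    (Real.rpow_pos_of_pos hy _).ne', ← Real.rpow_mul hy.le,
    show 1 / (2 - β) * (1 - β + 1) = 1 by field_simp; ring, Real.rpow_one, mul_div_cancel₀ _ hα.ne']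

lemma sub_sq_le_of_le_add {u s e η M : ℝ} (hu : |u| ≤ M) (hs : |s| ≤ M) (he : 0 ≤ e) (hη : 0 ≤ η)
    (hM : 4 * M * η ≤ 1) (h : u ≤ s + e) : u - 4 * η * u ^ 2 ≤ s - η * s ^ 2 + 2 * e := by
  have hM0 : 0 ≤ M := (abs_nonneg u).trans hu
  have hu1 := (abs_le.1 hu).1
  obtain ⟨hs1, hs2⟩ := abs_le.1 hs
  have hηu : 0 ≤ η * u ^ 2 := by positivity
  rcases le_total u s with hus | hus
  · rcases le_total (s ^ 2) (4 * u ^ 2) with hsq | hsq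
    · nlinarith
    · have hs0 : 0 ≤ s := by
        by_contra! hneg
        nlinarith
      have hus2 : 2 * u ≤ s := by nlinarith
      have hηs : η * s ^ 2 ≤ η * M * s := by
        nlinarith [mul_le_mul_of_nonneg_left hs2 (mul_nonneg hη hs0)]
      nlinarith
  · have hsq : s ^ 2 - u ^ 2 ≤ (u - s) * (2 * M) := by
      nlinarith [mul_le_mul_of_nonneg_left (show -(u + s) ≤ 2 * M by linarith) (sub_nonneg.2 hus)]
    nlinarith [mul_le_mul_of_nonneg_left hsq hη, mul_nonneg hη hM0]

lemma exp_sub_sq_le {X : ℝ} (hX : |X| ≤ 2 / 5) : Real.exp (X - X ^ 2) ≤ 1 + X := by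
  obtain ⟨h1, h2⟩ := abs_le.1 hX
  rcases le_total 0 X with h0 | h0
  · have hy : |X - X ^ 2| ≤ 1 := by rw [abs_le]; constructor <;> nlinarith
    have hexp := (abs_le.1 (Real.abs_exp_sub_one_sub_id_le hy)).2
    have hsq : (X - X ^ 2) ^ 2 ≤ X ^ 2 := by
      rw [show (X - X ^ 2) ^ 2 = X ^ 2 * (1 - X) ^ 2 by ring]
      exact mul_le_of_le_one_right (sq_nonneg X) (by nlinarith)
    linarith
  · have hexp := Real.quadratic_le_exp_of_nonneg (show 0 ≤ X ^ 2 - X by nlinarith)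
    have hpoly : 1 ≤ (1 + X) * (1 + (X ^ 2 - X) + (X ^ 2 - X) ^ 2 / 2) := by
      have hfac : 0 ≤ (1 - X) ^ 2 * (1 + X) / 2 + X := by
        nlinarith [mul_nonneg (neg_nonneg.2 h0) (neg_nonneg.2 h0)]
      nlinarith [mul_nonneg (sq_nonneg X) hfac]
    rw [← neg_sub, Real.exp_neg, inv_le_iff_one_le_mul₀ (Real.exp_pos _)]
    exact hpoly.trans (mul_le_mul_of_nonneg_left hexp (by linarith))

lemma exp_sq_sub_le {X : ℝ} (hX : |X| ≤ 1 / 2) : Real.exp (X ^ 2 - X) ≤ 1 - X + 4 * X ^ 2 := by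
  obtain ⟨h1, h2⟩ := abs_le.1 hX
  have hy : |X ^ 2 - X| ≤ 1 := by rw [abs_le]; constructor <;> nlinarith
  have hexp := (abs_le.1 (Real.abs_exp_sub_one_sub_id_le hy)).2
  have hsq : (X ^ 2 - X) ^ 2 ≤ 3 * X ^ 2 := by
    rw [show (X ^ 2 - X) ^ 2 = (1 - X) ^ 2 * X ^ 2 by ring]
    exact mul_le_mul_of_nonneg_right (by nlinarith) (sq_nonneg X)
  linarith

lemma sub_sq_convexCombination_le {r q p η G : ℝ} (hp0 : 0 ≤ p) (hp : p ≤ 1 / 2) (hη : 0 ≤ η)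
    (hq : |q| ≤ 2 * G) :
    ((1 - p) * r + p * q) - 32 * η * ((1 - p) * r + p * q) ^ 2 ≤
      (1 - p) * (r - 4 * η * r ^ 2) + p * q + 128 * η * p ^ 2 * G ^ 2 := by
  have hq2 : q ^ 2 ≤ 4 * G ^ 2 := by
    linarith [sq_le_sq' (by linarith [(abs_le.1 hq).1]) (abs_le.1 hq).2]
  have hsq : r ^ 2 / 8 - 4 * p ^ 2 * G ^ 2 ≤ ((1 - p) * r + p * q) ^ 2 := by
    have hyoung : ((1 - p) * r) ^ 2 / 2 - (p * q) ^ 2 ≤ ((1 - p) * r + p * q) ^ 2 := by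
      nlinarith [sq_nonneg ((1 - p) * r + 2 * (p * q))]
    have hr : r ^ 2 / 4 ≤ ((1 - p) * r) ^ 2 := by
      nlinarith [mul_le_mul_of_nonneg_right (show 1 / 4 ≤ (1 - p) ^ 2 by nlinarith) (sq_nonneg r)]
    have hpq : (p * q) ^ 2 ≤ p ^ 2 * (4 * G ^ 2) := by
      rw [mul_pow]
      exact mul_le_mul_of_nonneg_left hq2 (sq_nonneg p)
    linarith
  nlinarith [mul_le_mul_of_nonneg_left hsq hη, show 0 ≤ p * (η * r ^ 2) by positivity]

/-! ### The learning rates -/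

lemma rate_pos {E : ℝ} (hE : 0 < E) (i : ℕ) : 0 < rate E i := by
  unfold rate; positivity

lemma rate_le {E : ℝ} (hE : 0 < E) {i : ℕ} (hi : 1 ≤ i) : rate E i ≤ (Real.exp 1 * E)⁻¹ := by
  unfold rate
  have : (1 : ℝ) ≤ i := by exact_mod_cast hi
  gcongr

lemma rate_eq_exp_one_mul_rate_succ (E : ℝ) (i : ℕ) : rate E i = Real.exp 1 * rate E (i + 1) := by
  unfold rate
  rw [Nat.cast_succ, Real.exp_add]
  field_simp

lemma one_le_numRates {E : ℝ} {T : ℕ} (h : Real.exp 1 ≤ E * T) : 1 ≤ numRates E T := by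
  refine Nat.le_floor ?_
  rwa [Nat.cast_one, Real.le_log_iff_exp_le ((Real.exp_pos 1).trans_le h)]

lemma mul_rate_numRates_le {E : ℝ} {T : ℕ} (hE : 1 ≤ E) (hT : 0 < T) :
    E * T * rate E (numRates E T) ≤ Real.exp 1 := by
  have hET : 0 < E * T := by positivity
  have hfloor : Real.log (E * T) - 1 < numRates E T := Nat.sub_one_lt_floor _
  have hexp : E * T ≤ Real.exp 1 * Real.exp (numRates E T) := by
    rw [← Real.exp_add, ← Real.log_le_iff_le_exp hET]
    linarith
  unfold rate
  rw [mul_inv_le_iff₀ (by positivity)]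
  nlinarith

lemma exists_rate_mul_le_one {E Q : ℝ} {T : ℕ} (hE : 1 ≤ E) (h : Real.exp 1 ≤ E * T) (hQ : 0 < Q)
    (hQT : Real.exp 1 * Q ≤ E * T) :
    ∃ i ∈ Finset.Icc 1 (numRates E T), Q * rate E i ≤ 1 ∧
      1 / rate E i ≤ Real.exp 1 * (Q + E) := by
  have hE0 : 0 < E := by linarith
  have he := Real.exp_pos 1
  have hT : 0 < T := by
    have := he.trans_le h
    exact_mod_cast pos_of_mul_pos_right this hE0.le
  have hN : 1 ≤ numRates E T ∧ Q * rate E (numRates E T) ≤ 1 := by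
    refine ⟨one_le_numRates h, ?_⟩
    nlinarith [mul_le_mul_of_nonneg_right hQT (rate_pos hE0 (numRates E T)).le,
      mul_rate_numRates_le hE hT]
  classical
  have hex : ∃ i, 1 ≤ i ∧ Q * rate E i ≤ 1 := ⟨_, hN⟩
  obtain ⟨hi, hQi⟩ := Nat.find_spec hex
  refine ⟨Nat.find hex, Finset.mem_Icc.2 ⟨hi, Nat.find_le hN⟩, hQi, ?_⟩
  rw [div_le_iff₀ (rate_pos hE0 _)]
  obtain hi1 | ⟨j, hj⟩ : Nat.find hex = 1 ∨ ∃ j, Nat.find hex = j + 2 := by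
    rcases hi.eq_or_lt with hi1 | hi1
    · exact .inl hi1.symm
    · exact .inr ⟨Nat.find hex - 2, by omega⟩
  · have hrate : Real.exp 1 * E * rate E 1 = 1 := by
      unfold rate
      rw [Nat.cast_one, mul_inv_cancel₀ (by positivity)]
    rw [hi1]
    nlinarith [mul_pos (mul_pos he hQ) (rate_pos hE0 1)]
  · have hmin := Nat.find_min hex (m := j + 1) (by omega)
    have hlt : 1 < Q * rate E (j + 1) := by
      by_contra! hle
      exact hmin ⟨by omega, hle⟩
    rw [rate_eq_exp_one_mul_rate_succ] at hlt
    rw [hj]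
    nlinarith [mul_pos (mul_pos he hE0) (rate_pos hE0 (j + 2))]

/-! ### Deterministic regret of the algorithm -/

section Squint

variable {d : ℕ} {E : ℝ} {T : ℕ} {grid : Finset (Fin d → ℝ)} {prior : (Fin d → ℝ) → ℝ}

lemma rawWeight_pos (hE : 0 < E) (hN : 1 ≤ numRates E T) (S : (Fin d → ℝ) → ℕ → ℝ)
    {θ : Fin d → ℝ} (hθ : 0 < prior θ) : 0 < rawWeight E T prior S θ :=
  Finset.sum_pos (fun i _ => mul_pos (mul_pos (rate_pos hE i) (Real.exp_pos _)) hθ)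
    (Finset.nonempty_Icc.2 hN)

lemma sum_rawWeight_pos (hE : 0 < E) (hN : 1 ≤ numRates E T) (hne : grid.Nonempty)
    (hprior : ∀ θ ∈ grid, 0 < prior θ) (S : (Fin d → ℝ) → ℕ → ℝ) :
    0 < ∑ θ ∈ grid, rawWeight E T prior S θ :=
  Finset.sum_pos (fun θ hθ => rawWeight_pos hE hN S (hprior θ hθ)) hne

lemma predict_mem (hE : 0 < E) (hN : 1 ≤ numRates E T) (hne : grid.Nonempty)
    (hprior : ∀ θ ∈ grid, 0 < prior θ) {s : Set (Fin d → ℝ)} (hs : Convex ℝ s)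
    (hgrid : ∀ θ ∈ grid, θ ∈ s) (S : (Fin d → ℝ) → ℕ → ℝ) : predict E T grid prior S ∈ s := by
  have hsum := sum_rawWeight_pos hE hN hne hprior S
  refine hs.sum_mem (fun θ hθ => (div_pos (rawWeight_pos hE hN S (hprior θ hθ)) hsum).le) ?_ hgrid
  rw [← Finset.sum_div, div_self hsum.ne']

lemma sum_rawWeight_mul_eq_zero (hE : 0 < E) (hN : 1 ≤ numRates E T) (hne : grid.Nonempty)
    (hprior : ∀ θ ∈ grid, 0 < prior θ) (S : (Fin d → ℝ) → ℕ → ℝ) (h : Fin d → ℝ) :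
    ∑ θ ∈ grid, rawWeight E T prior S θ * (h ⬝ᵥ (predict E T grid prior S - θ)) = 0 := by
  have hsum := (sum_rawWeight_pos hE hN hne hprior S).ne'
  have hpredict : h ⬝ᵥ predict E T grid prior S =
      (∑ θ ∈ grid, rawWeight E T prior S θ * (h ⬝ᵥ θ)) /
        ∑ θ ∈ grid, rawWeight E T prior S θ := by
    unfold predict
    rw [dotProduct_sum, Finset.sum_div]
    refine Finset.sum_congr rfl fun θ _ => ?_
    rw [dotProduct_smul, smul_eq_mul, div_mul_eq_mul_div]
  simp only [dotProduct_sub, mul_sub, Finset.sum_sub_distrib]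
  rw [← Finset.sum_mul, hpredict, mul_div_cancel₀ _ hsum, sub_self]

lemma potential_succ_le (hE : 0 < E) (hN : 1 ≤ numRates E T) (hne : grid.Nonempty)
    (hprior : ∀ θ ∈ grid, 0 < prior θ) (grad : ℕ → (Fin d → ℝ) → (Fin d → ℝ)) (n : ℕ)
    (hb : ∀ θ ∈ grid, ∀ i ∈ Finset.Icc 1 (numRates E T),
      |rate E i * (grad (n + 1) (squint E T grid prior grad n) ⬝ᵥ
        (squint E T grid prior grad n - θ))| ≤ 2 / 5) :
    ∑ θ ∈ grid, ∑ i ∈ Finset.Icc 1 (numRates E T),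
      prior θ * Real.exp (rate E i * squintState E T grid prior grad (n + 1) θ i) ≤
    ∑ θ ∈ grid, ∑ i ∈ Finset.Icc 1 (numRates E T),
      prior θ * Real.exp (rate E i * squintState E T grid prior grad n θ i) := by
  let S := squintState E T grid prior grad n
  let r (θ : Fin d → ℝ) : ℝ :=
    grad (n + 1) (squint E T grid prior grad n) ⬝ᵥ (squint E T grid prior grad n - θ)
  have hterm : ∀ θ ∈ grid, ∀ i ∈ Finset.Icc 1 (numRates E T),
      prior θ * Real.exp (rate E i * squintState E T grid prior grad (n + 1) θ i) ≤
      prior θ * Real.exp (rate E i * S θ i) +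
        rate E i * Real.exp (rate E i * S θ i) * prior θ * r θ := by
    intro θ hθ i hi
    have hstate : rate E i * squintState E T grid prior grad (n + 1) θ i =
        rate E i * S θ i + (rate E i * r θ - (rate E i * r θ) ^ 2) := by
      change rate E i * (S θ i + (r θ - rate E i * r θ ^ 2)) = _
      ring
    rw [hstate, Real.exp_add]
    nlinarith [mul_le_mul_of_nonneg_left (exp_sub_sq_le (hb θ hθ i hi))
      (mul_pos (hprior θ hθ) (Real.exp_pos (rate E i * S θ i))).le]
  calc _ ≤ ∑ θ ∈ grid, ∑ i ∈ Finset.Icc 1 (numRates E T),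
        (prior θ * Real.exp (rate E i * S θ i) +
          rate E i * Real.exp (rate E i * S θ i) * prior θ * r θ) :=
      Finset.sum_le_sum fun θ hθ => Finset.sum_le_sum fun i hi => hterm θ hθ i hi
    _ = (∑ θ ∈ grid, ∑ i ∈ Finset.Icc 1 (numRates E T),
          prior θ * Real.exp (rate E i * S θ i)) +
        ∑ θ ∈ grid, rawWeight E T prior S θ * r θ := by
      simp only [Finset.sum_add_distrib, rawWeight, Finset.sum_mul]
    _ = _ := by
      rw [show ∑ θ ∈ grid, rawWeight E T prior S θ * r θ = 0 from
        sum_rawWeight_mul_eq_zero hE hN hne hprior S _, add_zero]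

lemma potential_le (hE : 0 < E) (hN : 1 ≤ numRates E T) (hne : grid.Nonempty)
    (hprior : ∀ θ ∈ grid, 0 < prior θ) (grad : ℕ → (Fin d → ℝ) → (Fin d → ℝ)) (n : ℕ)
    (hb : ∀ t < n, ∀ θ ∈ grid, ∀ i ∈ Finset.Icc 1 (numRates E T),
      |rate E i * (grad (t + 1) (squint E T grid prior grad t) ⬝ᵥ
        (squint E T grid prior grad t - θ))| ≤ 2 / 5) :
    ∑ θ ∈ grid, ∑ i ∈ Finset.Icc 1 (numRates E T),
      prior θ * Real.exp (rate E i * squintState E T grid prior grad n θ i) ≤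
    numRates E T * ∑ θ ∈ grid, prior θ := by
  induction n with
  | zero => simp [squintState, Finset.mul_sum]
  | succ n ih =>
    exact (potential_succ_le hE hN hne hprior grad n (hb n n.lt_succ_self)).trans
      (ih fun t ht => hb t (ht.trans n.lt_succ_self))

lemma rate_mul_squintState_le (hE : 0 < E) (hN : 1 ≤ numRates E T)
    (hprior : ∀ θ ∈ grid, 0 < prior θ) (grad : ℕ → (Fin d → ℝ) → (Fin d → ℝ)) (n : ℕ)
    (hb : ∀ t < n, ∀ θ ∈ grid, ∀ i ∈ Finset.Icc 1 (numRates E T),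
      |rate E i * (grad (t + 1) (squint E T grid prior grad t) ⬝ᵥ
        (squint E T grid prior grad t - θ))| ≤ 2 / 5)
    {θ : Fin d → ℝ} (hθ : θ ∈ grid) {i : ℕ} (hi : i ∈ Finset.Icc 1 (numRates E T)) :
    rate E i * squintState E T grid prior grad n θ i ≤
      Real.log (numRates E T * (∑ θ' ∈ grid, prior θ') / prior θ) := by
  have hne : grid.Nonempty := ⟨θ, hθ⟩
  have hN0 : (0 : ℝ) < numRates E T := by exact_mod_cast hN
  have hsum : 0 < ∑ θ' ∈ grid, prior θ' := Finset.sum_pos hprior hne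
  have hnonneg : ∀ θ' ∈ grid, ∀ j ∈ Finset.Icc 1 (numRates E T),
      0 ≤ prior θ' * Real.exp (rate E j * squintState E T grid prior grad n θ' j) :=
    fun θ' hθ' j _ => mul_nonneg (hprior θ' hθ').le (Real.exp_pos _).le
  rw [Real.le_log_iff_exp_le (div_pos (mul_pos hN0 hsum) (hprior θ hθ)), le_div_iff₀' (hprior θ hθ)]
  calc _ ≤ ∑ j ∈ Finset.Icc 1 (numRates E T),
        prior θ * Real.exp (rate E j * squintState E T grid prior grad n θ j) :=
      Finset.single_le_sum (hnonneg θ hθ) hi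
    _ ≤ _ := Finset.single_le_sum (fun θ' hθ' => Finset.sum_nonneg (hnonneg θ' hθ')) hθ
    _ ≤ _ := potential_le hE hN hne hprior grad n hb

lemma squintState_eq_sum (grad : ℕ → (Fin d → ℝ) → (Fin d → ℝ)) (n : ℕ) (θ : Fin d → ℝ) (i : ℕ) :
    squintState E T grid prior grad n θ i = ∑ t ∈ Finset.range n,
      (grad (t + 1) (squint E T grid prior grad t) ⬝ᵥ (squint E T grid prior grad t - θ) -
        rate E i * (grad (t + 1) (squint E T grid prior grad t) ⬝ᵥ
          (squint E T grid prior grad t - θ)) ^ 2) := by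
  induction n with
  | zero => rfl
  | succ n ih => rw [Finset.sum_range_succ, ← ih]; rfl

lemma uniformPrior_pos (hne : grid.Nonempty) (θ : Fin d → ℝ) : 0 < uniformPrior grid θ := by
  have : 0 < grid.card := hne.card_pos
  unfold uniformPrior
  positivity

lemma sum_uniformPrior (hne : grid.Nonempty) : ∑ θ ∈ grid, uniformPrior grid θ = 1 := by
  simp [uniformPrior, hne.ne_empty]

end Squint

/-! ### Exponential supermartingales -/

section Supermartingale

variable {Ω : Type*} {m₀ m : MeasurableSpace Ω} {μ : Measure[m] Ω}

lemma integrable_exp_condExp_mul_one_sub [IsFiniteMeasure μ] (hm : m₀ ≤ m) {Y : Ω → ℝ} {C : ℝ}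
    (hY : AEStronglyMeasurable Y μ) (hb : ∀ᵐ ω ∂μ, |Y ω| ≤ C) :
    Integrable (fun ω => Real.exp ((μ[Y | m₀]) ω) * (1 - Y ω)) μ := by
  have hexp : StronglyMeasurable[m₀] fun ω => Real.exp ((μ[Y | m₀]) ω) :=
    Real.continuous_exp.comp_stronglyMeasurable stronglyMeasurable_condExp
  refine ((integrable_const 1).sub (Integrable.of_bound hY C hb)).bdd_mul
    (hexp.mono hm).aestronglyMeasurable (c := Real.exp C) ?_
  filter_upwards [ae_bdd_abs_condExp_of_ae_bdd_abs (m := m₀) hb] with ω hω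
  rw [Real.norm_eq_abs, Real.abs_exp]
  exact Real.exp_le_exp.2 (abs_le.1 hω).2

lemma condExp_exp_condExp_mul_one_sub_le_one [IsFiniteMeasure μ] (hm : m₀ ≤ m) {Y : Ω → ℝ}
    {C : ℝ} (hY : AEStronglyMeasurable Y μ) (hb : ∀ᵐ ω ∂μ, |Y ω| ≤ C) :
    μ[fun ω => Real.exp ((μ[Y | m₀]) ω) * (1 - Y ω) | m₀] ≤ᵐ[μ] 1 := by
  have hexp : StronglyMeasurable[m₀] fun ω => Real.exp ((μ[Y | m₀]) ω) :=
    Real.continuous_exp.comp_stronglyMeasurable stronglyMeasurable_condExp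
  have hYi : Integrable Y μ := .of_bound hY C hb
  have h1 : Integrable (fun _ : Ω => (1 : ℝ)) μ := integrable_const 1
  filter_upwards [condExp_mul_of_stronglyMeasurable_left hexp
    (integrable_exp_condExp_mul_one_sub hm hY hb) (h1.sub hYi), condExp_sub h1 hYi m₀]
    with ω hpull hsub
  have hcond : (μ[(fun _ => 1) - Y | m₀]) ω = 1 - (μ[Y | m₀]) ω := by
    rw [hsub, condExp_const hm]
    rfl
  calc _ = Real.exp ((μ[Y | m₀]) ω) * (1 - (μ[Y | m₀]) ω) := by rw [← hcond]; exact hpull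
    _ ≤ Real.exp ((μ[Y | m₀]) ω) * Real.exp (-(μ[Y | m₀]) ω) :=
      mul_le_mul_of_nonneg_left (Real.one_sub_le_exp_neg _) (Real.exp_pos _).le
    _ = 1 := by rw [← Real.exp_add, add_neg_cancel, Real.exp_zero]

lemma condExp_exp_compensated_le_one [IsFiniteMeasure μ] (hm : m₀ ≤ m) {X : Ω → ℝ}
    (hX : StronglyMeasurable X) (hb : ∀ᵐ ω ∂μ, |X ω| ≤ 1 / 2) :
    μ[fun ω => Real.exp ((μ[fun ω' => X ω' - 4 * X ω' ^ 2 | m₀]) ω - (X ω - X ω ^ 2)) | m₀]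
      ≤ᵐ[μ] 1 := by
  let Y : Ω → ℝ := fun ω => X ω - 4 * X ω ^ 2
  have hYm : AEStronglyMeasurable Y μ :=
    (hX.sub ((hX.pow 2).const_mul 4)).aestronglyMeasurable
  have hYb : ∀ᵐ ω ∂μ, |Y ω| ≤ 3 / 2 := by
    filter_upwards [hb] with ω hω
    obtain ⟨h1, h2⟩ := abs_le.1 hω
    rw [abs_le]
    constructor <;> simp only [Y] <;> nlinarith
  have hle : (fun ω => Real.exp ((μ[Y | m₀]) ω - (X ω - X ω ^ 2))) ≤ᵐ[μ]
      fun ω => Real.exp ((μ[Y | m₀]) ω) * (1 - Y ω) := by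
    filter_upwards [hb] with ω hω
    have hsplit : (μ[Y | m₀]) ω - (X ω - X ω ^ 2) = (μ[Y | m₀]) ω + (X ω ^ 2 - X ω) := by ring
    rw [hsplit, Real.exp_add]
    exact mul_le_mul_of_nonneg_left ((exp_sq_sub_le hω).trans_eq (by ring)) (Real.exp_pos _).le
  have hdom := integrable_exp_condExp_mul_one_sub hm hYm hYb
  have hint : Integrable (fun ω => Real.exp ((μ[Y | m₀]) ω - (X ω - X ω ^ 2))) μ := by
    refine hdom.mono' (Real.continuous_exp.comp_stronglyMeasurable
      ((stronglyMeasurable_condExp.mono hm).sub (hX.sub (hX.pow 2)))).aestronglyMeasurable ?_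
    filter_upwards [hle] with ω hω
    rwa [Real.norm_eq_abs, Real.abs_exp]
  exact (condExp_mono hint hdom hle).trans (condExp_exp_condExp_mul_one_sub_le_one hm hYm hYb)

variable {F : Filtration ℕ m} {D : ℕ → Ω → ℝ} {C : ℝ}

lemma stronglyMeasurable_exp_sum_range (hD : ∀ t, StronglyMeasurable[F (t + 1)] (D t)) (n : ℕ) :
    StronglyMeasurable[F n] fun ω => Real.exp (∑ t ∈ Finset.range n, D t ω) :=
  Real.continuous_exp.comp_stronglyMeasurable <| Finset.stronglyMeasurable_fun_sum _
    fun t ht => (hD t).mono (F.mono (Finset.mem_range.1 ht))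

lemma integrable_exp_sum_range [IsFiniteMeasure μ]
    (hD : ∀ t, StronglyMeasurable[F (t + 1)] (D t)) (hC : ∀ t, ∀ᵐ ω ∂μ, |D t ω| ≤ C) (n : ℕ) :
    Integrable (fun ω => Real.exp (∑ t ∈ Finset.range n, D t ω)) μ := by
  refine .of_bound ((stronglyMeasurable_exp_sum_range hD n).mono (F.le n)).aestronglyMeasurable
    (Real.exp (n * C)) ?_
  filter_upwards [ae_all_iff.2 hC] with ω hω
  rw [Real.norm_eq_abs, Real.abs_exp]
  apply Real.exp_le_exp.2
  calc _ ≤ ∑ _t ∈ Finset.range n, C := Finset.sum_le_sum fun t _ => (le_abs_self _).trans (hω t)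
    _ = n * C := by simp

lemma integral_exp_sum_range_le_one [IsProbabilityMeasure μ]
    (hD : ∀ t, StronglyMeasurable[F (t + 1)] (D t)) (hC : ∀ t, ∀ᵐ ω ∂μ, |D t ω| ≤ C)
    (hle : ∀ t, μ[fun ω => Real.exp (D t ω) | F t] ≤ᵐ[μ] 1) (n : ℕ) :
    ∫ ω, Real.exp (∑ t ∈ Finset.range n, D t ω) ∂μ ≤ 1 := by
  induction n with
  | zero => simp
  | succ n ih =>
    let Z : Ω → ℝ := fun ω => Real.exp (∑ t ∈ Finset.range n, D t ω)
    let W : Ω → ℝ := fun ω => Real.exp (D n ω)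
    have hsplit : (fun ω => Real.exp (∑ t ∈ Finset.range (n + 1), D t ω)) = Z * W := by
      ext ω
      rw [Finset.sum_range_succ, Real.exp_add]
      rfl
    have hZ : Integrable Z μ := integrable_exp_sum_range hD hC n
    have hZW : Integrable (Z * W) μ := hsplit ▸ integrable_exp_sum_range hD hC (n + 1)
    have hW : Integrable W μ := by
      refine .of_bound (Real.continuous_exp.comp_stronglyMeasurable
        ((hD n).mono (F.le _))).aestronglyMeasurable (Real.exp C) ?_
      filter_upwards [hC n] with ω hω
      rw [Real.norm_eq_abs, Real.abs_exp]
      exact Real.exp_le_exp.2 ((le_abs_self _).trans hω)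
    refine le_trans ?_ ih
    rw [hsplit, ← integral_condExp (F.le n)]
    refine integral_mono_ae integrable_condExp hZ ?_
    filter_upwards [hle n, condExp_mul_of_stronglyMeasurable_left
      (stronglyMeasurable_exp_sum_range hD n) hZW hW] with ω hω hpull
    rw [hpull]
    exact mul_le_of_le_one_right (Real.exp_pos _).le hω

lemma measure_le_sum_range_le_exp_neg [IsProbabilityMeasure μ]
    (hD : ∀ t, StronglyMeasurable[F (t + 1)] (D t)) (hC : ∀ t, ∀ᵐ ω ∂μ, |D t ω| ≤ C)
    (hle : ∀ t, μ[fun ω => Real.exp (D t ω) | F t] ≤ᵐ[μ] 1) (n : ℕ) (y : ℝ) :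
    μ {ω | y ≤ ∑ t ∈ Finset.range n, D t ω} ≤ ENNReal.ofReal (Real.exp (-y)) := by
  have hint : Integrable (fun ω => Real.exp (1 * ∑ t ∈ Finset.range n, D t ω)) μ := by
    simpa only [one_mul] using integrable_exp_sum_range hD hC n
  have hmgf : ProbabilityTheory.mgf (fun ω => ∑ t ∈ Finset.range n, D t ω) μ 1 ≤ 1 := by
    simpa only [ProbabilityTheory.mgf, one_mul] using integral_exp_sum_range_le_one hD hC hle n
  rw [← ofReal_measureReal]
  refine ENNReal.ofReal_le_ofReal ?_
  calc _ ≤ Real.exp (-1 * y) * _ := ProbabilityTheory.measure_ge_le_exp_mul_mgf y zero_le_one hint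
    _ ≤ Real.exp (-1 * y) * 1 := by gcongr
    _ = Real.exp (-y) := by rw [mul_one, neg_one_mul]

end Supermartingale

/-! ### Random points -/

section RandomPoints

variable {Ω : Type*} {m₀ m : MeasurableSpace Ω} {μ : Measure[m] Ω}

lemma condExp_comp_nonneg {ι : Type*} [Countable ι] [MeasurableSpace ι]
    [MeasurableSingletonClass ι] {Φ : ι → Ω → ℝ} (hΦ : ∀ i, Integrable (Φ i) μ)
    (h0 : ∀ i, 0 ≤ᵐ[μ] μ[Φ i | m₀]) {N : Ω → ι} (hN : Measurable[m₀] N)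
    (hi : Integrable (fun ω => Φ (N ω) ω) μ) :
    0 ≤ᵐ[μ] μ[fun ω => Φ (N ω) ω | m₀] := by
  suffices h : ∀ i, ∀ᵐ ω ∂μ, N ω = i → 0 ≤ (μ[fun ω => Φ (N ω) ω | m₀]) ω by
    filter_upwards [ae_all_iff.2 h] with ω hω
    exact hω _ rfl
  intro i
  have hA : MeasurableSet[m₀] (N ⁻¹' {i}) := hN (measurableSet_singleton i)
  have heq : (N ⁻¹' {i}).indicator (fun ω => Φ (N ω) ω) = (N ⁻¹' {i}).indicator (Φ i) :=
    Set.indicator_congr fun ω (hω : N ω = i) => by rw [hω]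
  have hcond := condExp_indicator (m := m₀) hi hA
  rw [heq] at hcond
  filter_upwards [hcond, condExp_indicator (m := m₀) (hΦ i) hA, h0 i] with ω hcond hcondi hω hNω
  rw [hcondi, Set.indicator_of_mem (show ω ∈ N ⁻¹' {i} from hNω),
    Set.indicator_of_mem (show ω ∈ N ⁻¹' {i} from hNω)] at hcond
  exact hω.trans_eq hcond

lemma exists_measurable_dist_denseSeq_lt {E : Type*} [PseudoMetricSpace E] [Nonempty E]
    [TopologicalSpace.SeparableSpace E] [MeasurableSpace E] [OpensMeasurableSpace E]
    {p : Ω → E} (hp : Measurable p) {ε : ℝ} (hε : 0 < ε) :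
    ∃ N : Ω → ℕ, Measurable N ∧
      ∀ ω, dist (p ω) (TopologicalSpace.denseSeq E (N ω)) < ε := by
  classical
  have hex (ω : Ω) : ∃ n, dist (p ω) (TopologicalSpace.denseSeq E n) < ε := by
    obtain ⟨n, hn⟩ := (TopologicalSpace.denseRange_denseSeq E).exists_dist_lt (p ω) hε
    exact ⟨n, hn⟩
  refine ⟨fun ω => Nat.find (hex ω), measurable_find hex fun n => ?_,
    fun ω => Nat.find_spec (hex ω)⟩
  exact hp (isOpen_lt (continuous_id.dist continuous_const) continuous_const).measurableSet

lemma exists_lipschitz_modification {E : Type*} [PseudoMetricSpace E] {s : Set E}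
    (hs : TopologicalSpace.IsSeparable s) {K : NNReal} {Y : E → Ω → ℝ}
    (hY : ∀ x ∈ s, ∀ y ∈ s, ∀ᵐ ω ∂μ, dist (Y x ω) (Y y ω) ≤ K * dist x y) :
    ∃ L : E → Ω → ℝ, (∀ x ∈ s, L x =ᵐ[μ] Y x) ∧ ∀ ω, LipschitzWith K fun x => L x ω := by
  classical
  obtain ⟨c, hcs, hc, hsc⟩ := hs.exists_countable_dense_subset
  have hlip : ∀ᵐ ω ∂μ, LipschitzOnWith K (fun x => Y x ω) c := by
    simp only [lipschitzOnWith_iff_dist_le_mul]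
    exact (ae_ball_iff hc).2 fun x hx => (ae_ball_iff hc).2 fun y hy => hY x (hcs hx) y (hcs hy)
  have hext : ∀ ω, ∃ f : E → ℝ, LipschitzWith K f ∧
      (LipschitzOnWith K (fun x => Y x ω) c → Set.EqOn (fun x => Y x ω) f c) := by
    intro ω
    by_cases hω : LipschitzOnWith K (fun x => Y x ω) c
    · obtain ⟨f, hf, hfY⟩ := hω.extend_real
      exact ⟨f, hf, fun _ => hfY⟩
    · exact ⟨0, LipschitzWith.const' 0, fun h => absurd h hω⟩
  choose f hf hfY using hext
  refine ⟨fun x ω => f ω x, fun x hx => ?_, hf⟩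
  filter_upwards [hlip, (ae_ball_iff hc).2 fun y hy => hY x hx y (hcs hy)] with ω hω hxω
  refine eq_of_forall_dist_le fun ε hε => ?_
  obtain ⟨y, hy, hxy⟩ := Metric.mem_closure_iff.1 (hsc hx) (ε / (2 * (K + 1))) (by positivity)
  have hYf : Y y ω = f ω y := hfY ω hω hy
  calc dist (f ω x) (Y x ω) ≤ dist (f ω x) (f ω y) + dist (Y x ω) (Y y ω) := by
        rw [hYf, dist_comm (Y x ω)]
        exact dist_triangle _ _ _
    _ ≤ K * dist x y + K * dist x y := add_le_add ((hf ω).dist_le_mul x y) (hxω y hy)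
    _ ≤ 2 * (K + 1) * dist x y := by nlinarith [dist_nonneg (x := x) (y := y)]
    _ ≤ ε := by rw [lt_div_iff₀' (by positivity)] at hxy; exact hxy.le

lemma ae_forall_le_of_forall_ae_le {Z : Type*} [TopologicalSpace Z]
    [TopologicalSpace.SeparableSpace Z] {P : Ω → Prop} {f : Z → Ω → ℝ} {b : Z → ℝ}
    (hf : ∀ᵐ ω ∂μ, Continuous fun z => f z ω) (hb : Continuous b)
    (h : ∀ z, ∀ᵐ ω ∂μ, P ω → f z ω ≤ b z) : ∀ᵐ ω ∂μ, P ω → ∀ z, f z ω ≤ b z := by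
  obtain ⟨c, hc, hdense⟩ := TopologicalSpace.exists_countable_dense Z
  filter_upwards [hf, (ae_ball_iff hc).2 fun z _ => h z] with ω hfω hω hPω z
  exact (isClosed_le hfω hb).closure_subset_iff.2 (fun y hy => hω y hy hPω) (hdense z)

end RandomPoints

/-! ### Linearised losses -/

section Surrogate

variable {d : ℕ} {Ω : Type*}

/-- The instantaneous linearised regret `∇ℓ_t(p)ᵀ(p - θ)` of the (random) prediction `p` against
`θ` in round `t`. -/
noncomputable def linRegret (g : ℕ → Ω → (Fin d → ℝ) → (Fin d → ℝ)) (t : ℕ) (p : Ω → (Fin d → ℝ))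
    (θ : Fin d → ℝ) (ω : Ω) : ℝ :=
  g t ω (p ω) ⬝ᵥ (p ω - θ)

/-- The second-order surrogate `r - c r²` of the instantaneous linearised regret `r`. -/
noncomputable def surrogate (g : ℕ → Ω → (Fin d → ℝ) → (Fin d → ℝ)) (c : ℝ) (t : ℕ)
    (p : Ω → (Fin d → ℝ)) (θ : Fin d → ℝ) (ω : Ω) : ℝ :=
  linRegret g t p θ ω - c * linRegret g t p θ ω ^ 2

/-- The slack in bounding the instantaneous regret of `p` against `θ` by its surrogate up to `ρ`.
Convexity makes it nonnegative for `c = ρ = 0`; weak exp-concavity makes it nonnegative in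
conditional mean for some positive `c`. -/
noncomputable def surrogateGap (ℓ : ℕ → Ω → (Fin d → ℝ) → ℝ)
    (g : ℕ → Ω → (Fin d → ℝ) → (Fin d → ℝ)) (c ρ : ℝ) (t : ℕ) (p : Ω → (Fin d → ℝ))
    (θ : Fin d → ℝ) (ω : Ω) : ℝ :=
  surrogate g c t p θ ω + ρ - (ℓ t ω (p ω) - ℓ t ω θ)

end Surrogate

section Integrability

variable {Ω : Type*} {m : MeasurableSpace Ω} {μ : Measure Ω} [IsFiniteMeasure μ] {f : Ω → ℝ}
  {M : ℝ}

lemma integrable_sub_mul_sq (hf : Measurable f) (hb : ∀ᵐ ω ∂μ, |f ω| ≤ M) (c : ℝ) :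
    Integrable (fun ω => f ω - c * f ω ^ 2) μ := by
  have hfi : Integrable f μ := .of_bound hf.aestronglyMeasurable M hb
  have hsq : Integrable (fun ω => f ω * f ω) μ := hfi.mul_bdd hf.aestronglyMeasurable hb
  simp only [sq]
  exact hfi.sub (hsq.const_mul c)

lemma integrable_powInv_mul_sq (hf : Measurable f) (hb : ∀ᵐ ω ∂μ, |f ω| ≤ M) {α β : ℝ}
    (hα : 0 ≤ α) (hβ : 0 ≤ β) : Integrable (fun ω => powInv (α * f ω ^ 2) β) μ := by
  unfold powInv
  split_ifs
  · exact integrable_zero _ _ _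
  · refine .of_bound (((hf.pow_const 2).const_mul α).pow_const _).aestronglyMeasurable
      ((α * M ^ 2) ^ (1 / β)) ?_
    filter_upwards [hb] with ω hω
    rw [Real.norm_of_nonneg (by positivity), ← sq_abs (f ω)]
    gcongr

end Integrability

section Loss

variable {d : ℕ} {Ω : Type*} {m : MeasurableSpace Ω} {μ : Measure Ω} {F : Filtration ℕ m}
  {ℓ : ℕ → Ω → (Fin d → ℝ) → ℝ} {g : ℕ → Ω → (Fin d → ℝ) → (Fin d → ℝ)} {G : ℝ} {t : ℕ}
  {p : Ω → (Fin d → ℝ)} {θ : Fin d → ℝ}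

lemma IsRandomConvexLoss.measurable_loss_comp (h : IsRandomConvexLoss μ F ℓ g)
    (hp : Measurable[F (t + 1)] p) : Measurable[F (t + 1)] fun ω => ℓ (t + 1) ω (p ω) := by
  have huncurry : Measurable[MeasurableSpace.pi.prod (F (t + 1))]
      (Function.uncurry fun θ ω => ℓ (t + 1) ω θ) :=
    measurable_uncurry_of_continuous_of_measurable (m := F (t + 1))
      (fun ω => (h.convex _ (by omega) ω).locallyLipschitz.continuous)
      (h.measurable_loss _ (by omega))
  exact huncurry.comp (hp.prodMk measurable_id)

lemma IsRandomConvexLoss.measurable_linRegret (h : IsRandomConvexLoss μ F ℓ g)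
    (hp : Measurable[F (t + 1)] p) (θ : Fin d → ℝ) :
    Measurable[F (t + 1)] (linRegret g (t + 1) p θ) := by
  have hgrad : Measurable[F (t + 1)] fun ω => g (t + 1) ω (p ω) :=
    (h.measurable_grad _ (by omega)).comp (measurable_id.prodMk hp)
  unfold linRegret dotProduct
  exact Finset.measurable_fun_sum _ fun i _ => ((measurable_pi_apply i).comp hgrad).mul
    (((measurable_pi_apply i).comp hp).sub_const (θ i))

lemma LipschitzLoss.abs_linRegret_le (hG : LipschitzLoss μ g G) (hG0 : 0 ≤ G)
    (hpb : ∀ ω, p ω ∈ l1Ball d) (hθ : θ ∈ l1Ball d) :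
    ∀ᵐ ω ∂μ, |linRegret g (t + 1) p θ ω| ≤ 2 * G := by
  filter_upwards [hG] with ω hω
  exact abs_dotProduct_sub_le hG0 (hω _ (by omega) _ (hpb ω)) (hpb ω) hθ

lemma IsRandomConvexLoss.sub_le_dotProduct (h : IsRandomConvexLoss μ F ℓ g) (ω : Ω)
    (θ θ' : Fin d → ℝ) :
    ℓ (t + 1) ω θ - ℓ (t + 1) ω θ' ≤ g (t + 1) ω θ ⬝ᵥ (θ - θ') := by
  have hsub := h.subgradient (t + 1) (by omega) ω θ θ'
  rw [← neg_sub θ θ', dotProduct_neg] at hsub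
  linarith

lemma IsRandomConvexLoss.abs_sub_le (h : IsRandomConvexLoss μ F ℓ g) {ω : Ω}
    (hω : ∀ θ ∈ l1Ball d, ∀ i, |g (t + 1) ω θ i| ≤ G) {θ' : Fin d → ℝ} (hθ : θ ∈ l1Ball d)
    (hθ' : θ' ∈ l1Ball d) : |ℓ (t + 1) ω θ - ℓ (t + 1) ω θ'| ≤ G * l1norm (θ - θ') := by
  have hle (θ₁ θ₂ : Fin d → ℝ) (h₁ : θ₁ ∈ l1Ball d) :
      ℓ (t + 1) ω θ₁ - ℓ (t + 1) ω θ₂ ≤ G * l1norm (θ₁ - θ₂) :=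
    (h.sub_le_dotProduct ω θ₁ θ₂).trans ((le_abs_self _).trans (abs_dotProduct_le (hω θ₁ h₁) _))
  have hsymm := hle θ' θ hθ'
  rw [← neg_sub θ θ', l1norm_neg] at hsymm
  exact abs_le.2 ⟨by linarith, hle θ θ' hθ⟩

lemma IsRandomConvexLoss.condExp_surrogateGap_zero_nonneg (h : IsRandomConvexLoss μ F ℓ g) :
    0 ≤ᵐ[μ] μ[surrogateGap ℓ g 0 0 (t + 1) p θ | F t] := by
  refine condExp_nonneg (.of_forall fun ω => ?_)
  have hsub := h.sub_le_dotProduct (t := t) ω (p ω) θ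
  simp only [surrogateGap, surrogate, linRegret, zero_mul, sub_zero, add_zero]
  exact sub_nonneg.2 hsub

lemma IsRandomConvexLoss.exists_isCondRisk (h : IsRandomConvexLoss μ F ℓ g)
    (hG : LipschitzLoss μ g G) (hG0 : 0 ≤ G) :
    ∃ L : ℕ → (Fin d → ℝ) → Ω → ℝ, IsCondRisk μ F ℓ L := by
  have hlip (t : ℕ) : ∀ θ ∈ l1Ball d, ∀ θ' ∈ l1Ball d, ∀ᵐ ω ∂μ,
      dist ((μ[fun ω => ℓ (t + 1) ω θ | F t]) ω) ((μ[fun ω => ℓ (t + 1) ω θ' | F t]) ω) ≤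
        (G * d).toNNReal * dist θ θ' := by
    intro θ hθ θ' hθ'
    have hloss : ∀ᵐ ω ∂μ, |((fun ω => ℓ (t + 1) ω θ) - fun ω => ℓ (t + 1) ω θ') ω| ≤
        (G * d).toNNReal * dist θ θ' := by
      filter_upwards [hG] with ω hω
      rw [Real.coe_toNNReal _ (by positivity), dist_eq_norm, mul_assoc]
      exact (h.abs_sub_le (hω _ (by omega)) hθ hθ').trans
        (mul_le_mul_of_nonneg_left (l1norm_le_mul_norm _) hG0)
    filter_upwards [ae_bdd_abs_condExp_of_ae_bdd_abs (m := F t) hloss,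
      condExp_sub (h.integrable (t + 1) (by omega) θ hθ)
        (h.integrable (t + 1) (by omega) θ' hθ') (F t)]
      with ω hbound hsub
    rwa [hsub] at hbound
  choose L hL hLlip using fun t =>
    exists_lipschitz_modification (TopologicalSpace.IsSeparable.of_separableSpace _) (hlip t)
  refine ⟨fun t => L (t - 1), fun t ht θ hθ => ?_, .of_forall fun ω t _ =>
    (hLlip _ ω).continuous.continuousOn⟩
  obtain ⟨t, rfl⟩ := Nat.exists_eq_add_of_le' ht
  exact hL t θ hθ

section Finite

variable [IsFiniteMeasure μ]

lemma IsRandomConvexLoss.integrable_comp (h : IsRandomConvexLoss μ F ℓ g)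
    (hG : LipschitzLoss μ g G) (hG0 : 0 ≤ G) (hp : Measurable[F (t + 1)] p)
    (hpb : ∀ ω, p ω ∈ l1Ball d) : Integrable (fun ω => ℓ (t + 1) ω (p ω)) μ := by
  have h0 := h.integrable (t + 1) (by omega) 0 zero_mem_l1Ball
  have hm : Measurable fun ω => ℓ (t + 1) ω (p ω) :=
    (h.measurable_loss_comp hp).mono (F.le _) le_rfl
  have hdiff : Integrable (fun ω => ℓ (t + 1) ω (p ω) - ℓ (t + 1) ω 0) μ := by
    refine .of_bound (hm.aestronglyMeasurable.sub h0.aestronglyMeasurable) G ?_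
    filter_upwards [hG] with ω hω
    have hp1 : l1norm (p ω - 0) ≤ 1 := by
      rw [sub_zero]
      exact hpb ω
    exact (h.abs_sub_le (hω _ (by omega)) (hpb ω) zero_mem_l1Ball).trans
      (mul_le_of_le_one_right hG0 hp1)
  exact (hdiff.add h0).congr (.of_forall fun ω => sub_add_cancel _ _)

lemma IsRandomConvexLoss.integrable_surrogate (h : IsRandomConvexLoss μ F ℓ g)
    (hG : LipschitzLoss μ g G) (hG0 : 0 ≤ G) (hp : Measurable[F (t + 1)] p)
    (hpb : ∀ ω, p ω ∈ l1Ball d) (hθ : θ ∈ l1Ball d) (c : ℝ) :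
    Integrable (surrogate g c (t + 1) p θ) μ :=
  integrable_sub_mul_sq ((h.measurable_linRegret hp θ).mono (F.le _) le_rfl)
    (hG.abs_linRegret_le hG0 hpb hθ) c

lemma IsRandomConvexLoss.integrable_surrogateGap (h : IsRandomConvexLoss μ F ℓ g)
    (hG : LipschitzLoss μ g G) (hG0 : 0 ≤ G) (hp : Measurable[F (t + 1)] p)
    (hpb : ∀ ω, p ω ∈ l1Ball d) (hθ : θ ∈ l1Ball d) (c ρ : ℝ) :
    Integrable (surrogateGap ℓ g c ρ (t + 1) p θ) μ :=
  ((h.integrable_surrogate hG hG0 hp hpb hθ c).add (integrable_const ρ)).sub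
    ((h.integrable_comp hG hG0 hp hpb).sub (h.integrable _ (by omega) θ hθ))

lemma WeakExpConcave.condExp_surrogateGap_const_nonneg {α β ρ c : ℝ}
    (hw : WeakExpConcave μ F ℓ g α β) (h : IsRandomConvexLoss μ F ℓ g) (hG : LipschitzLoss μ g G)
    (hG0 : 0 ≤ G) (hα : 0 < α) (hβ0 : 0 ≤ β) (hβ1 : β ≤ 1) (hρ : 0 < ρ)
    (hc : c ≤ α * ρ ^ (1 - β)) {z : Fin d → ℝ} (hz : z ∈ l1Ball d) (hθ : θ ∈ l1Ball d) :
    0 ≤ᵐ[μ] μ[surrogateGap ℓ g c ρ (t + 1) (fun _ => z) θ | F t] := by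
  obtain ⟨hw0, hw1⟩ := hw (t + 1) (by omega) z hz θ hθ
  rw [Nat.add_sub_cancel] at hw1
  let r : Ω → ℝ := linRegret g (t + 1) (fun _ => z) θ
  let q : Ω → ℝ := fun ω => powInv (α * r ω ^ 2) β
  let Δ : Ω → ℝ := fun ω => ℓ (t + 1) ω z - ℓ (t + 1) ω θ
  have hrm : Measurable r := (h.measurable_linRegret measurable_const θ).mono (F.le _) le_rfl
  have hrb : ∀ᵐ ω ∂μ, |r ω| ≤ 2 * G := hG.abs_linRegret_le hG0 (fun _ => hz) hθ
  have hr : Integrable r μ := .of_bound hrm.aestronglyMeasurable _ hrb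
  have hq : Integrable q μ := integrable_powInv_mul_sq hrm hrb hα.le hβ0
  have hΔ : Integrable Δ μ :=
    (h.integrable _ (by omega) z hz).sub (h.integrable _ (by omega) θ hθ)
  have hle : r - q - Δ ≤ᵐ[μ] surrogateGap ℓ g c ρ (t + 1) (fun _ => z) θ := by
    have hβ : ∀ᵐ ω ∂μ, β = 0 → α * r ω ^ 2 ≤ 1 := Filter.eventually_imp_distrib_left.2 hw0
    filter_upwards [hβ] with ω hω
    have hpow : α * ρ ^ (1 - β) * r ω ^ 2 ≤ q ω + ρ :=
      mul_le_powInv_add hα hβ0 hβ1 hρ (sq_nonneg (r ω)) hω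
    have hcr := mul_le_mul_of_nonneg_right hc (sq_nonneg (r ω))
    change r ω - q ω - Δ ω ≤ r ω - c * r ω ^ 2 + ρ - Δ ω
    linarith
  filter_upwards [hw1, condExp_sub (hr.sub hq) hΔ (F t), condExp_sub hr hq (F t),
    condExp_mono (m := F t) ((hr.sub hq).sub hΔ)
      (h.integrable_surrogateGap hG hG0 measurable_const (fun _ => hz) hθ c ρ) hle]
    with ω hw1 hsub hsub' hmono
  rw [hsub, Pi.sub_apply, hsub', Pi.sub_apply] at hmono
  exact (sub_nonneg.2 hw1).trans hmono

end Finite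

lemma dotProduct_le_of_monotone_of_close {a b p z θ : Fin d → ℝ} {ε : ℝ}
    (ha : ∀ i, |a i| ≤ G) (hb : ∀ i, |b i| ≤ G) (hG0 : 0 ≤ G) (hε : 0 < ε)
    (hmono : b ⬝ᵥ (p - z) ≤ a ⬝ᵥ (p - z))
    (hclose : l1norm ((1 - ε) • p + ε • θ - z) ≤ ε ^ 2) :
    b ⬝ᵥ (p - θ) ≤ a ⬝ᵥ (p - θ) + 2 * (G * ε) := by
  set v := (1 - ε) • p + ε • θ - z with hv
  have hpz : p - z = ε • (p - θ) + v := by rw [hv]; module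
  have hGv : G * l1norm v ≤ G * ε ^ 2 := mul_le_mul_of_nonneg_left hclose hG0
  have hav := (abs_le.1 ((abs_dotProduct_le ha v).trans hGv)).2
  have hbv := (abs_le.1 ((abs_dotProduct_le hb v).trans hGv)).1
  rw [hpz, dotProduct_add, dotProduct_add, dotProduct_smul, dotProduct_smul, smul_eq_mul,
    smul_eq_mul] at hmono
  refine le_of_mul_le_mul_left ?_ hε
  linarith

lemma IsRandomConvexLoss.surrogateGap_le_add (h : IsRandomConvexLoss μ F ℓ g) (hG0 : 0 ≤ G) {ω : Ω}
    (hω : ∀ θ ∈ l1Ball d, ∀ i, |g (t + 1) ω θ i| ≤ G) {z : Ω → (Fin d → ℝ)}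
    (hp : p ω ∈ l1Ball d) (hz : z ω ∈ l1Ball d) (hθ : θ ∈ l1Ball d) {ε c ρ : ℝ} (hε0 : 0 < ε)
    (hε1 : ε ≤ 1) (hc0 : 0 ≤ c) (hc : 8 * G * c ≤ 1)
    (hclose : l1norm ((1 - ε) • p ω + ε • θ - z ω) ≤ ε ^ 2) :
    surrogateGap ℓ g (4 * c) ρ (t + 1) z θ ω ≤
      surrogateGap ℓ g c ρ (t + 1) p θ ω + 13 * G * ε := by
  set a := g (t + 1) ω (p ω)
  set b := g (t + 1) ω (z ω)
  set v := (1 - ε) • p ω + ε • θ - z ω with hv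
  have hpz : p ω - z ω = ε • (p ω - θ) + v := by rw [hv]; module
  have hε2 : ε ^ 2 ≤ ε := by nlinarith
  have hGv : G * l1norm v ≤ G * ε := mul_le_mul_of_nonneg_left (hclose.trans hε2) hG0
  have hbp := (abs_le.1 (abs_dotProduct_sub_le hG0 (hω _ hz) hp hθ)).1
  have hbv := (abs_le.1 ((abs_dotProduct_le (hω _ hz) v).trans hGv)).1
  have hap := (abs_le.1 (abs_dotProduct_sub_le hG0 (hω _ hp) hp hθ)).2
  have hav := (abs_le.1 ((abs_dotProduct_le (hω _ hp) v).trans hGv)).2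
  have hmono : b ⬝ᵥ (p ω - z ω) ≤ a ⬝ᵥ (p ω - z ω) := by
    have hzp := h.sub_le_dotProduct (t := t) ω (z ω) (p ω)
    rw [← neg_sub (p ω) (z ω), dotProduct_neg] at hzp
    linarith [h.sub_le_dotProduct (t := t) ω (p ω) (z ω)]
  have hlin : b ⬝ᵥ (z ω - θ) ≤ a ⬝ᵥ (p ω - θ) + 5 * (G * ε) := by
    have hzθ : z ω - θ = (p ω - θ) - ε • (p ω - θ) - v := by rw [hv]; module
    have hnear := dotProduct_le_of_monotone_of_close (hω _ hp) (hω _ hz) hG0 hε0 hmono hclose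
    rw [hzθ, dotProduct_sub, dotProduct_sub, dotProduct_smul, smul_eq_mul]
    nlinarith [mul_le_mul_of_nonneg_left hbp hε0.le]
  have hsurrogate := sub_sq_le_of_le_add (abs_dotProduct_sub_le hG0 (hω _ hz) hz hθ)
    (abs_dotProduct_sub_le hG0 (hω _ hp) hp hθ) (by positivity) hc0 (by linarith) hlin
  have hloss : ℓ (t + 1) ω (p ω) - ℓ (t + 1) ω (z ω) ≤ 3 * (G * ε) := by
    refine (h.sub_le_dotProduct ω (p ω) (z ω)).trans ?_
    rw [hpz, dotProduct_add, dotProduct_smul, smul_eq_mul]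
    nlinarith [mul_le_mul_of_nonneg_left hap hε0.le]
  simp only [surrogateGap, surrogate, linRegret]
  linarith

instance : Nonempty (l1Ball d) := ⟨0, zero_mem_l1Ball⟩

lemma exists_measurable_l1norm_sub_denseSeq_le {m₀ : MeasurableSpace Ω} {w : Ω → (Fin d → ℝ)}
    (hw : Measurable w) (hwb : ∀ ω, w ω ∈ l1Ball d) {δ : ℝ} (hδ : 0 < δ) :
    ∃ N : Ω → ℕ, Measurable N ∧
      ∀ ω, l1norm (w ω - (TopologicalSpace.denseSeq (l1Ball d) (N ω) : Fin d → ℝ)) ≤ δ := by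
  obtain ⟨N, hN, hdist⟩ := exists_measurable_dist_denseSeq_lt (hw.subtype_mk (h := hwb))
    (show 0 < δ / (d + 1) by positivity)
  refine ⟨N, hN, fun ω => (l1norm_le_mul_norm _).trans ?_⟩
  have hω := (hdist ω).le
  rw [Subtype.dist_eq, dist_eq_norm, le_div_iff₀ (by positivity)] at hω
  nlinarith [norm_nonneg (w ω - (TopologicalSpace.denseSeq (l1Ball d) (N ω) : Fin d → ℝ))]

variable [IsFiniteMeasure μ]

-- The inequality at fixed points cannot be used at the random point `p`, nor at nearby points of a
-- countable set, since subgradients are discontinuous. Moving from `p` slightly towards `θ` helps: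
-- by monotonicity of the subgradients, the linearised regret there is at most the one at `p`.
lemma IsRandomConvexLoss.condExp_surrogateGap_add_nonneg (h : IsRandomConvexLoss μ F ℓ g)
    (hG : LipschitzLoss μ g G) (hG0 : 0 ≤ G) {c ρ : ℝ} (hc0 : 0 ≤ c) (hc : 8 * G * c ≤ 1)
    (hp : Measurable[F t] p) (hpb : ∀ ω, p ω ∈ l1Ball d) (hθ : θ ∈ l1Ball d)
    (hconst : ∀ z ∈ l1Ball d, 0 ≤ᵐ[μ] μ[surrogateGap ℓ g (4 * c) ρ (t + 1) (fun _ => z) θ | F t])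
    {ε : ℝ} (hε0 : 0 < ε) (hε1 : ε ≤ 1) :
    ∀ᵐ ω ∂μ, 0 ≤ (μ[surrogateGap ℓ g c ρ (t + 1) p θ | F t]) ω + 13 * G * ε := by
  have hmono : F t ≤ F (t + 1) := F.mono t.le_succ
  have hwb (ω : Ω) : (1 - ε) • p ω + ε • θ ∈ l1Ball d :=
    convex_l1Ball (hpb ω) hθ (by linarith) hε0.le (by ring)
  obtain ⟨N, hN, hclose⟩ := exists_measurable_l1norm_sub_denseSeq_le (m₀ := F t)
    ((hp.const_smul (1 - ε)).add_const (ε • θ)) hwb (show 0 < ε ^ 2 by positivity)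
  let D : ℕ → Fin d → ℝ := fun n => TopologicalSpace.denseSeq (l1Ball d) n
  have hD (n : ℕ) : D n ∈ l1Ball d := Subtype.coe_prop _
  have hDm : Measurable[F (t + 1)] fun ω => D (N ω) :=
    (Measurable.of_discrete (f := D)).comp (hN.mono hmono le_rfl)
  have hDi := h.integrable_surrogateGap hG hG0 hDm (fun ω => hD _) hθ (4 * c) ρ
  have hpi := h.integrable_surrogateGap hG hG0 (hp.mono hmono le_rfl) hpb hθ c ρ
  have hεi : Integrable (fun _ : Ω => 13 * G * ε) μ := integrable_const _
  have hle : surrogateGap ℓ g (4 * c) ρ (t + 1) (fun ω => D (N ω)) θ ≤ᵐ[μ]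
      surrogateGap ℓ g c ρ (t + 1) p θ + fun _ => 13 * G * ε := by
    filter_upwards [hG] with ω hω
    exact h.surrogateGap_le_add hG0 (hω _ (by omega)) (hpb ω) (hD _) hθ hε0 hε1 hc0 hc (hclose ω)
  have hnonneg := condExp_comp_nonneg (m₀ := F t) (N := N)
    (Φ := fun n => surrogateGap ℓ g (4 * c) ρ (t + 1) (fun _ => D n) θ)
    (fun n => h.integrable_surrogateGap hG hG0 measurable_const (fun _ => hD n) hθ (4 * c) ρ)
    (fun n => hconst _ (hD n)) hN hDi
  filter_upwards [hnonneg, condExp_mono (m := F t) hDi (hpi.add hεi) hle,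
    condExp_add hpi hεi (F t)] with ω hω hleω hadd
  rw [hadd, Pi.add_apply, condExp_const (F.le t)] at hleω
  exact hω.trans hleω

lemma IsRandomConvexLoss.condExp_surrogateGap_nonneg_of_const (h : IsRandomConvexLoss μ F ℓ g)
    (hG : LipschitzLoss μ g G) (hG0 : 0 ≤ G) {c ρ : ℝ} (hc0 : 0 ≤ c) (hc : 8 * G * c ≤ 1)
    (hp : Measurable[F t] p) (hpb : ∀ ω, p ω ∈ l1Ball d) (hθ : θ ∈ l1Ball d)
    (hconst : ∀ z ∈ l1Ball d,
      0 ≤ᵐ[μ] μ[surrogateGap ℓ g (4 * c) ρ (t + 1) (fun _ => z) θ | F t]) :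
    0 ≤ᵐ[μ] μ[surrogateGap ℓ g c ρ (t + 1) p θ | F t] := by
  have happrox (n : ℕ) : ∀ᵐ ω ∂μ,
      0 ≤ (μ[surrogateGap ℓ g c ρ (t + 1) p θ | F t]) ω + 13 * G * (1 / ((n : ℝ) + 1)) :=
    h.condExp_surrogateGap_add_nonneg hG hG0 hc0 hc hp hpb hθ hconst Nat.one_div_pos_of_nat
      (div_le_one_of_le₀ (by linarith [n.cast_nonneg (α := ℝ)]) (by positivity))
  filter_upwards [ae_all_iff.2 happrox] with ω hω
  have hlim := (tendsto_one_div_add_atTop_nhds_zero_nat (𝕜 := ℝ)).const_mul (13 * G)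
  rw [mul_zero] at hlim
  simpa only [Pi.zero_apply, add_zero] using ge_of_tendsto' (hlim.const_add _) hω

lemma WeakExpConcave.condExp_surrogateGap_nonneg {α β ρ c : ℝ} (hw : WeakExpConcave μ F ℓ g α β)
    (h : IsRandomConvexLoss μ F ℓ g) (hG : LipschitzLoss μ g G) (hG0 : 0 ≤ G) (hα : 0 < α)
    (hβ0 : 0 ≤ β) (hβ1 : β ≤ 1) (hρ : 0 < ρ) (hc0 : 0 ≤ c) (hc : 4 * c ≤ α * ρ ^ (1 - β))
    (hcG : 8 * G * c ≤ 1) (hp : Measurable[F t] p) (hpb : ∀ ω, p ω ∈ l1Ball d)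
    (hθ : θ ∈ l1Ball d) : 0 ≤ᵐ[μ] μ[surrogateGap ℓ g c ρ (t + 1) p θ | F t] :=
  h.condExp_surrogateGap_nonneg_of_const hG hG0 hc0 hcG hp hpb hθ fun _ hz =>
    hw.condExp_surrogateGap_const_nonneg h hG hG0 hα hβ0 hβ1 hρ hc hz hθ

end Loss

/-! ### Conditional regret -/

section Regret

variable {d : ℕ} {Ω : Type*} {m : MeasurableSpace Ω}

/-- The cumulative conditional regret `∑_{t < T} E_t[ℓ_{t+1}(p_t) - ℓ_{t+1}(θ)]` of the
predictions `p` against `θ`. -/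
noncomputable def condRegret (μ : Measure Ω) (F : Filtration ℕ m) (ℓ : ℕ → Ω → (Fin d → ℝ) → ℝ)
    (p : ℕ → Ω → (Fin d → ℝ)) (T : ℕ) (θ : Fin d → ℝ) (ω : Ω) : ℝ :=
  ∑ t ∈ Finset.range T, (μ[fun ω' => ℓ (t + 1) ω' (p t ω') - ℓ (t + 1) ω' θ | F t]) ω

/-- The cumulative conditional second-order surrogate of the regret of the predictions `p` against
`θ`: the sum of the conditional means of `r_t - c r_t²`. -/
noncomputable def condSurrogateSum (μ : Measure Ω) (F : Filtration ℕ m)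
    (g : ℕ → Ω → (Fin d → ℝ) → (Fin d → ℝ)) (c : ℝ) (p : ℕ → Ω → (Fin d → ℝ)) (T : ℕ)
    (θ : Fin d → ℝ) (ω : Ω) : ℝ :=
  ∑ t ∈ Finset.range T, (μ[surrogate g c (t + 1) (p t) θ | F t]) ω

variable {μ : Measure Ω} [IsFiniteMeasure μ] {F : Filtration ℕ m}
  {ℓ : ℕ → Ω → (Fin d → ℝ) → ℝ} {g : ℕ → Ω → (Fin d → ℝ) → (Fin d → ℝ)} {G : ℝ}

section Domination

variable {ι : Type*} {K : Finset ι} {pt : ι → (Fin d → ℝ)} {cf v : ι → ℝ} {η ρ c : ℝ}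
  {θ : Fin d → ℝ}

lemma IsRandomConvexLoss.condExp_sub_le_sum (h : IsRandomConvexLoss μ F ℓ g)
    (hG : LipschitzLoss μ g G) (hG0 : 0 ≤ G) {t : ℕ} {p : Ω → (Fin d → ℝ)}
    (hp : Measurable[F t] p) (hpb : ∀ ω, p ω ∈ l1Ball d) (hθ : θ ∈ l1Ball d)
    (hpt : ∀ k ∈ K, pt k ∈ l1Ball d)
    (hgap : 0 ≤ᵐ[μ] μ[surrogateGap ℓ g η ρ (t + 1) p θ | F t])
    (hdom : ∀ a z : Fin d → ℝ, (∀ i, |a i| ≤ G) → z ∈ l1Ball d →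
      a ⬝ᵥ (z - θ) - η * (a ⬝ᵥ (z - θ)) ^ 2 ≤
        ∑ k ∈ K, v k * (a ⬝ᵥ (z - pt k) - cf k * (a ⬝ᵥ (z - pt k)) ^ 2) + c) :
    ∀ᵐ ω ∂μ, (μ[fun ω' => ℓ (t + 1) ω' (p ω') - ℓ (t + 1) ω' θ | F t]) ω ≤
      ∑ k ∈ K, v k * (μ[surrogate g (cf k) (t + 1) p (pt k) | F t]) ω + (c + ρ) := by
  have hp' : Measurable[F (t + 1)] p := hp.mono (F.mono t.le_succ) le_rfl
  have hΔ : Integrable (fun ω => ℓ (t + 1) ω (p ω) - ℓ (t + 1) ω θ) μ :=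
    (h.integrable_comp hG hG0 hp' hpb).sub (h.integrable _ (by omega) θ hθ)
  have hΓ := h.integrable_surrogateGap hG hG0 hp' hpb hθ η ρ
  have hv (k : ι) (hk : k ∈ K) : Integrable (v k • surrogate g (cf k) (t + 1) p (pt k)) μ :=
    (h.integrable_surrogate hG hG0 hp' hpb (hpt k hk) (cf k)).smul (v k)
  have hS : Integrable (∑ k ∈ K, v k • surrogate g (cf k) (t + 1) p (pt k)) μ :=
    integrable_finsetSum' _ hv
  have hC : Integrable (fun _ : Ω => c + ρ) μ := integrable_const _
  have hle : (fun ω => ℓ (t + 1) ω (p ω) - ℓ (t + 1) ω θ) + surrogateGap ℓ g η ρ (t + 1) p θ ≤ᵐ[μ]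
      (∑ k ∈ K, v k • surrogate g (cf k) (t + 1) p (pt k)) + fun _ => c + ρ := by
    filter_upwards [hG] with ω hω
    have hdomω := hdom _ _ (hω (t + 1) (by omega) _ (hpb ω)) (hpb ω)
    simp only [Pi.add_apply, Finset.sum_apply, Pi.smul_apply, smul_eq_mul, surrogateGap, surrogate,
      linRegret]
    linarith
  filter_upwards [hgap, condExp_mono (m := F t) (hΔ.add hΓ) (hS.add hC) hle,
    condExp_add hΔ hΓ (F t), condExp_add hS hC (F t), condExp_finsetSum hv (F t),
    (Finset.eventually_all K).2 fun k _ =>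
      condExp_smul (μ := μ) (v k) (surrogate g (cf k) (t + 1) p (pt k)) (F t)]
    with ω hgap hmono hadd hadd' hsum hsmul
  rw [hadd, hadd', Pi.add_apply, Pi.add_apply, hsum, Finset.sum_apply, condExp_const (F.le t),
    Finset.sum_congr rfl hsmul] at hmono
  exact (le_add_of_nonneg_right hgap).trans hmono

lemma IsRandomConvexLoss.condRegret_le_sum (h : IsRandomConvexLoss μ F ℓ g)
    (hG : LipschitzLoss μ g G) (hG0 : 0 ≤ G) {p : ℕ → Ω → (Fin d → ℝ)}
    (hp : ∀ t, Measurable[F t] (p t)) (hpb : ∀ t ω, p t ω ∈ l1Ball d) (hθ : θ ∈ l1Ball d)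
    (hpt : ∀ k ∈ K, pt k ∈ l1Ball d)
    (hgap : ∀ t, 0 ≤ᵐ[μ] μ[surrogateGap ℓ g η ρ (t + 1) (p t) θ | F t])
    (hdom : ∀ a z : Fin d → ℝ, (∀ i, |a i| ≤ G) → z ∈ l1Ball d →
      a ⬝ᵥ (z - θ) - η * (a ⬝ᵥ (z - θ)) ^ 2 ≤
        ∑ k ∈ K, v k * (a ⬝ᵥ (z - pt k) - cf k * (a ⬝ᵥ (z - pt k)) ^ 2) + c) (T : ℕ) :
    ∀ᵐ ω ∂μ, condRegret μ F ℓ p T θ ω ≤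
      ∑ k ∈ K, v k * condSurrogateSum μ F g (cf k) p T (pt k) ω + T * (c + ρ) := by
  filter_upwards [ae_all_iff.2 fun t =>
    h.condExp_sub_le_sum hG hG0 (hp t) (hpb t) hθ hpt (hgap t) hdom] with ω hω
  calc _ ≤ ∑ t ∈ Finset.range T,
        (∑ k ∈ K, v k * (μ[surrogate g (cf k) (t + 1) (p t) (pt k) | F t]) ω + (c + ρ)) :=
      Finset.sum_le_sum fun t _ => hω t
    _ = _ := by
      simp only [condSurrogateSum, Finset.mul_sum, Finset.sum_add_distrib, Finset.sum_const,
        Finset.card_range, nsmul_eq_mul]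
      rw [Finset.sum_comm, mul_add]

end Domination

lemma dotProduct_sub_le_sum_of_convexCombination {grid : Finset (Fin d → ℝ)}
    (hgrid : ∀ k ∈ grid, k ∈ l1Ball d) {w : (Fin d → ℝ) → ℝ} {ξ : Fin d → ℝ}
    (hw0 : ∀ k ∈ grid, 0 ≤ w k) (hw1 : ∑ k ∈ grid, w k = 1) (hξ : ∑ k ∈ grid, w k • k = ξ)
    (hG0 : 0 ≤ G) {c : ℝ} (hc : 0 ≤ c) {a z : Fin d → ℝ} (ha : ∀ i, |a i| ≤ G)
    (hz : z ∈ l1Ball d) :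
    a ⬝ᵥ (z - ξ) ≤
      ∑ k ∈ grid, w k * (a ⬝ᵥ (z - k) - 4 * c * (a ⬝ᵥ (z - k)) ^ 2) + 16 * c * G ^ 2 := by
  have hmean : a ⬝ᵥ (z - ξ) = ∑ k ∈ grid, w k * (a ⬝ᵥ (z - k)) := by
    simp only [dotProduct_sub, mul_sub, Finset.sum_sub_distrib]
    rw [← Finset.sum_mul, hw1, one_mul, ← hξ, dotProduct_sum]
    simp only [dotProduct_smul, smul_eq_mul]
  have hterm : ∀ k ∈ grid, w k * (a ⬝ᵥ (z - k)) ≤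
      w k * (a ⬝ᵥ (z - k) - 4 * c * (a ⬝ᵥ (z - k)) ^ 2) + w k * (16 * c * G ^ 2) := by
    intro k hk
    obtain ⟨hlow, hupp⟩ := abs_le.1 (abs_dotProduct_sub_le hG0 ha hz (hgrid k hk))
    have hsq := mul_le_mul_of_nonneg_left (sq_le_sq' hlow hupp) hc
    rw [← mul_add]
    exact mul_le_mul_of_nonneg_left (by linarith) (hw0 k hk)
  calc _ ≤ _ := hmean.trans_le (Finset.sum_le_sum hterm)
    _ = _ := by rw [Finset.sum_add_distrib, ← Finset.sum_mul, hw1, one_mul]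

variable {p : ℕ → Ω → (Fin d → ℝ)} {grid : Finset (Fin d → ℝ)} {θ ξ k : Fin d → ℝ}

lemma IsRandomConvexLoss.condRegret_le_two_mul (h : IsRandomConvexLoss μ F ℓ g)
    (hG : LipschitzLoss μ g G) (hG0 : 0 ≤ G) (hp : ∀ t, Measurable[F t] (p t))
    (hpb : ∀ t ω, p t ω ∈ l1Ball d) (hθ : θ ∈ l1Ball d) (T : ℕ) :
    ∀ᵐ ω ∂μ, condRegret μ F ℓ p T θ ω ≤ T * (2 * G) := by
  have hdom (a z : Fin d → ℝ) (ha : ∀ i, |a i| ≤ G) (hz : z ∈ l1Ball d) :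
      a ⬝ᵥ (z - θ) - 0 * (a ⬝ᵥ (z - θ)) ^ 2 ≤
        ∑ k ∈ (∅ : Finset (Fin d → ℝ)), (0 : (Fin d → ℝ) → ℝ) k *
          (a ⬝ᵥ (z - k) - (0 : (Fin d → ℝ) → ℝ) k * (a ⬝ᵥ (z - k)) ^ 2) + 2 * G := by
    simpa using (abs_le.1 (abs_dotProduct_sub_le hG0 ha hz hθ)).2
  simpa using h.condRegret_le_sum hG hG0 hp hpb hθ (by simp)
    (fun _ => h.condExp_surrogateGap_zero_nonneg) hdom T

lemma IsRandomConvexLoss.condRegret_le_of_mem_convexHull (h : IsRandomConvexLoss μ F ℓ g)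
    (hG : LipschitzLoss μ g G) (hG0 : 0 ≤ G) (hp : ∀ t, Measurable[F t] (p t))
    (hpb : ∀ t ω, p t ω ∈ l1Ball d) (hgrid : ∀ k ∈ grid, k ∈ l1Ball d) (hθ : θ ∈ l1Ball d)
    (hθ' : θ ∈ convexHull ℝ (grid : Set (Fin d → ℝ))) {c : ℝ} (hc : 0 < c) (T : ℕ) (b : ℝ) :
    ∀ᵐ ω ∂μ, (∀ k ∈ grid, c * condSurrogateSum μ F g (4 * c) p T k ω ≤ b) →
      condRegret μ F ℓ p T θ ω ≤ b / c + T * (16 * c * G ^ 2) := by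
  obtain ⟨w, hw0, hw1, hwθ⟩ := Finset.mem_convexHull'.1 hθ'
  have hdom (a z : Fin d → ℝ) (ha : ∀ i, |a i| ≤ G) (hz : z ∈ l1Ball d) :
      a ⬝ᵥ (z - θ) - 0 * (a ⬝ᵥ (z - θ)) ^ 2 ≤
        ∑ k ∈ grid, w k * (a ⬝ᵥ (z - k) - 4 * c * (a ⬝ᵥ (z - k)) ^ 2) + 16 * c * G ^ 2 := by
    rw [zero_mul, sub_zero]
    exact dotProduct_sub_le_sum_of_convexCombination hgrid hw0 hw1 hwθ hG0 hc.le ha hz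
  filter_upwards [h.condRegret_le_sum hG hG0 hp hpb hθ (pt := fun k => k) hgrid
    (fun _ => h.condExp_surrogateGap_zero_nonneg) hdom T] with ω hω hb
  rw [add_zero] at hω
  refine hω.trans (add_le_add_left ?_ _)
  exact (convex_Iic (b / c)).sum_mem hw0 hw1 fun k hk => (le_div_iff₀' hc).2 (hb k hk)

lemma IsRandomConvexLoss.condRegret_convexCombination_le (h : IsRandomConvexLoss μ F ℓ g)
    (hG : LipschitzLoss μ g G) (hG0 : 0 ≤ G) (hp : ∀ t, Measurable[F t] (p t))
    (hpb : ∀ t ω, p t ω ∈ l1Ball d) (hgrid : ∀ k ∈ grid, k ∈ l1Ball d) (hk : k ∈ grid)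
    (hξ : ξ ∈ l1Ball d) (hξ' : ξ ∈ convexHull ℝ (grid : Set (Fin d → ℝ))) {π c₁ c₂ ρ : ℝ}
    (hπ0 : 0 ≤ π) (hπ : π ≤ 1 / 2) (hc₁ : 0 < c₁) (hc₂ : 0 < c₂)
    (hgap : ∀ t, 0 ≤ᵐ[μ]
      μ[surrogateGap ℓ g (32 * c₁) ρ (t + 1) (p t) ((1 - π) • k + π • ξ) | F t])
    (T : ℕ) (b : ℝ) :
    ∀ᵐ ω ∂μ, c₁ * condSurrogateSum μ F g (4 * c₁) p T k ω ≤ b →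
      (∀ j ∈ grid, c₂ * condSurrogateSum μ F g (4 * c₂) p T j ω ≤ b) →
      condRegret μ F ℓ p T ((1 - π) • k + π • ξ) ω ≤ (1 - π) * (b / c₁) + π * (b / c₂) +
        T * (π * (16 * c₂ * G ^ 2) + 128 * c₁ * π ^ 2 * G ^ 2 + ρ) := by
  obtain ⟨w, hw0, hw1, hwξ⟩ := Finset.mem_convexHull'.1 hξ'
  let pt : Option (Fin d → ℝ) → (Fin d → ℝ) := fun o => o.elim k fun j => j
  let cf : Option (Fin d → ℝ) → ℝ := fun o => o.elim (4 * c₁) fun _ => 4 * c₂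
  let v : Option (Fin d → ℝ) → ℝ := fun o => o.elim (1 - π) fun j => π * w j
  have hpt : ∀ o ∈ Finset.insertNone grid, pt o ∈ l1Ball d :=
    Finset.forall_mem_insertNone.2 ⟨hgrid k hk, hgrid⟩
  have hdom (a z : Fin d → ℝ) (ha : ∀ i, |a i| ≤ G) (hz : z ∈ l1Ball d) :
      a ⬝ᵥ (z - ((1 - π) • k + π • ξ)) - 32 * c₁ * (a ⬝ᵥ (z - ((1 - π) • k + π • ξ))) ^ 2 ≤
        ∑ o ∈ Finset.insertNone grid,
          v o * (a ⬝ᵥ (z - pt o) - cf o * (a ⬝ᵥ (z - pt o)) ^ 2) +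
        (π * (16 * c₂ * G ^ 2) + 128 * c₁ * π ^ 2 * G ^ 2) := by
    have hsplit : z - ((1 - π) • k + π • ξ) = (1 - π) • (z - k) + π • (z - ξ) := by module
    have hcurv := sub_sq_convexCombination_le (r := a ⬝ᵥ (z - k)) hπ0 hπ hc₁.le
      (abs_dotProduct_sub_le hG0 ha hz hξ)
    have hmean := mul_le_mul_of_nonneg_left
      (dotProduct_sub_le_sum_of_convexCombination hgrid hw0 hw1 hwξ hG0 hc₂.le ha hz) hπ0
    rw [hsplit, dotProduct_add, dotProduct_smul, dotProduct_smul, smul_eq_mul, smul_eq_mul,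
      Finset.sum_insertNone]
    simp only [pt, cf, v, Option.elim, mul_assoc π, ← Finset.mul_sum]
    linarith
  filter_upwards [h.condRegret_le_sum hG hG0 hp hpb
    (convex_l1Ball (hgrid k hk) hξ (by linarith) hπ0 (by ring)) hpt hgap hdom T] with ω hω hbk hb
  have hmean : ∑ j ∈ grid, w j * condSurrogateSum μ F g (4 * c₂) p T j ω ≤ b / c₂ :=
    (convex_Iic (b / c₂)).sum_mem hw0 hw1 fun j hj => (le_div_iff₀' hc₂).2 (hb j hj)
  rw [Finset.sum_insertNone] at hω
  simp only [pt, cf, v, Option.elim, mul_assoc π, ← Finset.mul_sum] at hω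
  refine hω.trans (add_le_add_left (add_le_add ?_ (mul_le_mul_of_nonneg_left hmean hπ0)) _)
  exact mul_le_mul_of_nonneg_left ((le_div_iff₀' hc₁).2 hbk) (by linarith)

end Regret

/-! ### Choice of the learning rates -/

section LearningRates

variable {G s ρ π : ℝ} {T : ℕ}

lemma one_le_cast_of_exp_one_le_mul (hGT : Real.exp 1 ≤ G * T) : (1 : ℝ) ≤ T := by
  refine Nat.one_le_cast.2 (Nat.one_le_iff_ne_zero.2 fun hT => ?_)
  rw [hT, Nat.cast_zero, mul_zero] at hGT
  exact hGT.not_gt (Real.exp_pos 1)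

lemma exists_rate_mul_le_four_mul (hE : 1 ≤ 8 * G / 3) (hGT : Real.exp 1 ≤ G * T) (hs : 0 < s)
    (hsT : 1 / 2 ≤ s ^ 2 * T) :
    ∃ i ∈ Finset.Icc 1 (numRates (8 * G / 3) T), G * rate (8 * G / 3) i ≤ 4 * s ∧
      s ^ 2 / rate (8 * G / 3) i ≤ G * s + 8 * (G * s ^ 2) := by
  have hG : 0 < G := by linarith
  have hsT' : 1 / 2 ≤ s * T := by
    have hT := one_le_cast_of_exp_one_le_mul hGT
    have hsq : (1 / 2) ^ 2 ≤ (s * T) ^ 2 := by nlinarith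
    exact (sq_le_sq₀ (by norm_num) (by positivity)).1 hsq
  have hQT : Real.exp 1 * (G / (4 * s)) ≤ 8 * G / 3 * T := by
    rw [← mul_div_assoc, div_le_iff₀ (by positivity)]
    nlinarith [Real.exp_one_lt_d9]
  obtain ⟨i, hi, hQi, hinv⟩ := exists_rate_mul_le_one hE (by linarith [Real.exp_pos 1])
    (div_pos hG (by positivity : 0 < 4 * s)) hQT
  rw [div_mul_eq_mul_div, div_le_one₀ (by positivity)] at hQi
  refine ⟨i, hi, hQi, ?_⟩
  calc _ ≤ s ^ 2 * (Real.exp 1 * (G / (4 * s) + 8 * G / 3)) := by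
        rw [div_eq_mul_one_div]; gcongr
    _ = Real.exp 1 * (G * s / 4 + 8 / 3 * (G * s ^ 2)) := by field_simp
    _ ≤ _ := by nlinarith [Real.exp_one_lt_d9, mul_pos hG hs, mul_pos hG (pow_pos hs 2)]

lemma exists_rate_le_of_mul_lt (hE : 1 ≤ 8 * G / 3) (hGT : Real.exp 1 ≤ G * T) (hs : 0 < s)
    (hsT : 1 / 2 ≤ s ^ 2 * T) (hρ : 0 ≤ ρ) (hπ : 0 ≤ π)
    (hbig : 4000 * (ρ + G * π * s + G * s ^ 2) < 2 * G) :
    ∃ i ∈ Finset.Icc 1 (numRates (8 * G / 3) T), 128 * ρ * rate (8 * G / 3) i ≤ s ^ 2 ∧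
      256 * G * rate (8 * G / 3) i ≤ 1 ∧ G * π * rate (8 * G / 3) i ≤ 4 * s ∧
      s ^ 2 / rate (8 * G / 3) i ≤ 705 * (ρ + G * π * s + G * s ^ 2) := by
  have hG : 0 < G := by linarith
  have hGs : 0 < G * s ^ 2 := by positivity
  have hGπs : 0 ≤ G * π * s := by positivity
  obtain ⟨Q, hQ⟩ : ∃ Q, Q = 128 * ρ / s ^ 2 + 256 * G + G * π / (4 * s) := ⟨_, rfl⟩
  have hQ0 : 0 < Q := by rw [hQ]; positivity
  have hQs : Q * s ^ 2 = 128 * ρ + 256 * (G * s ^ 2) + G * π * s / 4 := by rw [hQ]; field_simp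
  have hQT : Real.exp 1 * Q ≤ 8 * G / 3 * T := by
    have hQG : Q * (s ^ 2 * T) ≤ 0.128 * G * T := by
      rw [← mul_assoc]
      exact mul_le_mul_of_nonneg_right (by linarith) T.cast_nonneg
    nlinarith [Real.exp_one_lt_d9, mul_le_mul_of_nonneg_left hsT hQ0.le]
  obtain ⟨i, hi, hQi, hinv⟩ := exists_rate_mul_le_one hE (by linarith [Real.exp_pos 1]) hQ0 hQT
  have hr := rate_pos (by linarith : 0 < 8 * G / 3) i
  have hle {u : ℝ} (hu : u ≤ Q) : u * rate (8 * G / 3) i ≤ 1 :=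
    (mul_le_mul_of_nonneg_right hu hr.le).trans hQi
  have hρs : 0 ≤ 128 * ρ / s ^ 2 := by positivity
  have hπs : 0 ≤ G * π / (4 * s) := by positivity
  refine ⟨i, hi, ?_, hle (by linarith), ?_, ?_⟩
  · have hρi := hle (u := 128 * ρ / s ^ 2) (by linarith)
    rwa [div_mul_eq_mul_div, div_le_one₀ (by positivity)] at hρi
  · have hπi := hle (u := G * π / (4 * s)) (by linarith)
    rwa [div_mul_eq_mul_div, div_le_one₀ (by positivity)] at hπi
  · calc _ ≤ s ^ 2 * (Real.exp 1 * (Q + 8 * G / 3)) := by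
          rw [div_eq_mul_one_div]; gcongr
      _ = Real.exp 1 * (Q * s ^ 2 + 8 / 3 * (G * s ^ 2)) := by ring
      _ ≤ 2.72 * (Q * s ^ 2 + 8 / 3 * (G * s ^ 2)) := by
          gcongr
          linarith [Real.exp_one_lt_d9]
      _ ≤ _ := by rw [hQs]; linarith

end LearningRates

/-! ### The complexity term -/

section Complexity

variable {d : ℕ} {grid : Finset (Fin d → ℝ)} {G x : ℝ} {T : ℕ}

lemma one_le_log_of_exp_one_le {y : ℝ} (h : Real.exp 1 ≤ y) : 1 ≤ Real.log y :=
  (Real.le_log_iff_exp_le ((Real.exp_pos 1).trans_le h)).2 h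

lemma numRates_le_two_mul_log (hGT : Real.exp 1 ≤ G * T) :
    (numRates (8 * G / 3) T : ℝ) ≤ 2 * Real.log (G * T) := by
  have hlog := one_le_log_of_exp_one_le hGT
  have hmul : Real.log (8 * G / 3 * T) = Real.log (8 / 3) + Real.log (G * T) := by
    rw [← Real.log_mul (by norm_num) ((Real.exp_pos 1).trans_le hGT).ne']
    ring_nf
  have hle : Real.log (8 / 3) ≤ 1 := by
    rw [Real.log_le_iff_le_exp (by norm_num)]
    linarith [Real.exp_one_gt_d9]
  have hnonneg : 0 ≤ Real.log (8 / 3) := Real.log_nonneg (by norm_num)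
  exact (Nat.floor_le (by linarith)).trans (by linarith)

lemma half_le_complexityTerm (hcard : 2 ≤ grid.card) (hx : 0 < x)
    (hGT : Real.exp 1 ≤ G * T) : 1 / 2 ≤ complexityTerm grid G T x := by
  have hlog : Real.log 2 ≤ Real.log grid.card :=
    Real.log_le_log two_pos (by exact_mod_cast hcard)
  have hloglog := Real.log_nonneg (one_le_log_of_exp_one_le hGT)
  unfold complexityTerm
  linarith [Real.log_two_gt_d9]

lemma add_two_mul_log_le_complexityTerm (hcard : 2 ≤ grid.card) (hx : 0 < x)
    (hGT : Real.exp 1 ≤ G * T) :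
    x + 2 * Real.log (numRates (8 * G / 3) T * grid.card) ≤ 4 * complexityTerm grid G T x := by
  have hcard' : (2 : ℝ) ≤ grid.card := by exact_mod_cast hcard
  have hN : (0 : ℝ) < numRates (8 * G / 3) T :=
    Nat.cast_pos.2 (one_le_numRates (by linarith [Real.exp_pos 1]))
  have hlog := one_le_log_of_exp_one_le hGT
  have hlogN : Real.log (numRates (8 * G / 3) T) ≤ Real.log 2 + Real.log (Real.log (G * T)) := by
    rw [← Real.log_mul two_ne_zero (by linarith)]
    exact Real.log_le_log hN (numRates_le_two_mul_log hGT)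
  have hlog2 : Real.log 2 ≤ Real.log grid.card := Real.log_le_log two_pos hcard'
  rw [Real.log_mul hN.ne' (by linarith)]
  unfold complexityTerm
  linarith [Real.log_nonneg hlog]

end Complexity

/-! ### The regret event -/

section TailBound

variable {Ω : Type*} {m : MeasurableSpace Ω} {μ : Measure Ω} {F : Filtration ℕ m}

lemma measure_le_sum_condExp_compensated_le [IsProbabilityMeasure μ] {X : ℕ → Ω → ℝ}
    (hX : ∀ t, StronglyMeasurable[F (t + 1)] (X t)) (hb : ∀ t, ∀ᵐ ω ∂μ, |X t ω| ≤ 1 / 2) (n : ℕ)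
    (y : ℝ) :
    μ {ω | y ≤ ∑ t ∈ Finset.range n,
        ((μ[fun ω' => X t ω' - 4 * X t ω' ^ 2 | F t]) ω - (X t ω - X t ω ^ 2))} ≤
      ENNReal.ofReal (Real.exp (-y)) := by
  refine measure_le_sum_range_le_exp_neg (F := F) (C := 9 / 4) (fun t => ?_) (fun t => ?_)
    (fun t => condExp_exp_compensated_le_one (F.le t) ((hX t).mono (F.le _)) (hb t)) n y
  · exact (stronglyMeasurable_condExp.mono (F.mono t.le_succ)).sub ((hX t).sub ((hX t).pow 2))
  · have hbound : ∀ᵐ ω ∂μ, |X t ω - 4 * X t ω ^ 2| ≤ 3 / 2 := by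
      filter_upwards [hb t] with ω hω
      obtain ⟨hlow, hupp⟩ := abs_le.1 hω
      exact abs_le.2 ⟨by nlinarith, by nlinarith⟩
    filter_upwards [hb t, ae_bdd_abs_condExp_of_ae_bdd_abs (m := F t) hbound] with ω hω hcω
    obtain ⟨hlow, hupp⟩ := abs_le.1 hω
    obtain ⟨hclow, hcupp⟩ := abs_le.1 hcω
    exact abs_le.2 ⟨by nlinarith, by nlinarith⟩

variable {d : ℕ} {ℓ : ℕ → Ω → (Fin d → ℝ) → ℝ} {g : ℕ → Ω → (Fin d → ℝ) → (Fin d → ℝ)}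

lemma IsRandomConvexLoss.measure_condSurrogateSum_sub_ge_le [IsProbabilityMeasure μ]
    (h : IsRandomConvexLoss μ F ℓ g) {p : ℕ → Ω → (Fin d → ℝ)} (hp : ∀ t, Measurable[F t] (p t))
    {θ : Fin d → ℝ} {η : ℝ} (hb : ∀ t, ∀ᵐ ω ∂μ, |η * linRegret g (t + 1) (p t) θ ω| ≤ 1 / 2)
    (T : ℕ) (y : ℝ) :
    μ {ω | y ≤ η * condSurrogateSum μ F g (4 * η) p T θ ω -
        η * ∑ t ∈ Finset.range T, surrogate g η (t + 1) (p t) θ ω} ≤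
      ENNReal.ofReal (Real.exp (-y)) := by
  let X (t : ℕ) (ω : Ω) : ℝ := η * linRegret g (t + 1) (p t) θ ω
  have hX (t : ℕ) : StronglyMeasurable[F (t + 1)] (X t) :=
    ((h.measurable_linRegret ((hp t).mono (F.mono t.le_succ) le_rfl) θ).const_mul
      η).stronglyMeasurable
  have hcond (t : ℕ) : μ[fun ω => X t ω - 4 * X t ω ^ 2 | F t] =ᵐ[μ]
      η • μ[surrogate g (4 * η) (t + 1) (p t) θ | F t] := by
    convert condExp_smul (μ := μ) η (surrogate g (4 * η) (t + 1) (p t) θ) (F t) using 2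
    ext ω
    simp only [X, surrogate, Pi.smul_apply, smul_eq_mul]
    ring
  refine (measure_mono_ae ?_).trans (measure_le_sum_condExp_compensated_le hX hb T y)
  filter_upwards [ae_all_iff.2 hcond] with ω hω hy
  refine hy.trans_eq ?_
  rw [condSurrogateSum, Finset.mul_sum, Finset.mul_sum, ← Finset.sum_sub_distrib]
  refine Finset.sum_congr rfl fun t _ => ?_
  rw [hω t]
  simp only [X, surrogate, Pi.smul_apply, smul_eq_mul]
  ring

end TailBound

section Event

variable {d : ℕ} {Ω : Type*} {m : MeasurableSpace Ω}

/-- The event that, for every grid point `θ` and every learning rate `η_i`, the cumulative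
conditional surrogate with constant `4 η_i` is at most `b θ / η_i`. -/
def regretEvent (μ : Measure Ω) (F : Filtration ℕ m) (g : ℕ → Ω → (Fin d → ℝ) → (Fin d → ℝ))
    (E : ℝ) (p : ℕ → Ω → (Fin d → ℝ)) (T : ℕ) (grid : Finset (Fin d → ℝ))
    (b : (Fin d → ℝ) → ℝ) : Set Ω :=
  {ω | ∀ θ ∈ grid, ∀ i ∈ Finset.Icc 1 (numRates E T),
    rate E i * condSurrogateSum μ F g (4 * rate E i) p T θ ω ≤ b θ}

variable {μ : Measure Ω} {F : Filtration ℕ m} {ℓ : ℕ → Ω → (Fin d → ℝ) → ℝ}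
  {g : ℕ → Ω → (Fin d → ℝ) → (Fin d → ℝ)} {E G : ℝ} {T : ℕ} {grid : Finset (Fin d → ℝ)}
  {prior : (Fin d → ℝ) → ℝ}

lemma regretEvent_mono {p : ℕ → Ω → (Fin d → ℝ)} {b b' : (Fin d → ℝ) → ℝ}
    (h : ∀ θ ∈ grid, b θ ≤ b' θ) :
    regretEvent μ F g E p T grid b ⊆ regretEvent μ F g E p T grid b' :=
  fun _ hω θ hθ i hi => (hω θ hθ i hi).trans (h θ hθ)

lemma measurable_predict {m' : MeasurableSpace Ω} {S : Ω → (Fin d → ℝ) → ℕ → ℝ}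
    (hS : ∀ θ i, Measurable fun ω => S ω θ i) :
    Measurable fun ω => predict E T grid prior (S ω) := by
  have hraw (θ : Fin d → ℝ) : Measurable fun ω => rawWeight E T prior (S ω) θ :=
    Finset.measurable_sum _ fun i _ =>
      (((hS θ i).const_mul (rate E i)).exp.const_mul (rate E i)).mul_const _
  exact Finset.measurable_sum _ fun θ _ =>
    ((hraw θ).div (Finset.measurable_sum _ fun θ' _ => hraw θ')).smul_const θ

lemma IsRandomConvexLoss.measurable_squintState (h : IsRandomConvexLoss μ F ℓ g) (t : ℕ)
    (θ : Fin d → ℝ) (i : ℕ) :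
    Measurable[F t] fun ω => squintState E T grid prior (fun s => g s ω) t θ i := by
  induction t generalizing θ i with
  | zero => exact measurable_const
  | succ t ih =>
    have hS (θ : Fin d → ℝ) (i : ℕ) : Measurable[F (t + 1)] fun ω =>
        squintState E T grid prior (fun s => g s ω) t θ i :=
      (ih θ i).mono (F.mono t.le_succ) le_rfl
    have hp : Measurable[F (t + 1)] fun ω => squint E T grid prior (fun s => g s ω) t :=
      measurable_predict (m' := F (t + 1)) hS
    have hr := h.measurable_linRegret hp θ
    exact (hS θ i).add (hr.sub ((hr.pow_const 2).const_mul (rate E i)))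

lemma IsRandomConvexLoss.measurable_squint (h : IsRandomConvexLoss μ F ℓ g) (t : ℕ) :
    Measurable[F t] fun ω => squint E T grid prior (fun s => g s ω) t :=
  measurable_predict (m' := F t) (h.measurable_squintState t)

lemma LipschitzLoss.abs_rate_mul_linRegret_le (hG : LipschitzLoss μ g G) (hG0 : 0 ≤ G)
    (hE : 0 < E) (hGE : 5 * G ≤ Real.exp 1 * E) {t : ℕ} {p : Ω → (Fin d → ℝ)}
    (hpb : ∀ ω, p ω ∈ l1Ball d) {θ : Fin d → ℝ} (hθ : θ ∈ l1Ball d) {i : ℕ} (hi : 1 ≤ i) :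
    ∀ᵐ ω ∂μ, |rate E i * linRegret g (t + 1) p θ ω| ≤ 2 / 5 := by
  filter_upwards [hG.abs_linRegret_le hG0 hpb hθ] with ω hω
  rw [abs_mul, abs_of_pos (rate_pos hE i)]
  calc _ ≤ (Real.exp 1 * E)⁻¹ * (2 * G) :=
        mul_le_mul (rate_le hE hi) hω (abs_nonneg _) (by positivity)
    _ ≤ _ := by
      rw [inv_mul_le_iff₀ (by positivity)]
      linarith

lemma LipschitzLoss.rate_mul_sum_surrogate_le (hG : LipschitzLoss μ g G) (hG0 : 0 ≤ G)
    (hE : 0 < E) (hGE : 5 * G ≤ Real.exp 1 * E) (hN : 1 ≤ numRates E T)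
    (hprior : ∀ θ ∈ grid, 0 < prior θ) (hgrid : ∀ θ ∈ grid, θ ∈ l1Ball d) :
    ∀ᵐ ω ∂μ, ∀ θ ∈ grid, ∀ i ∈ Finset.Icc 1 (numRates E T),
      rate E i * ∑ t ∈ Finset.range T, surrogate g (rate E i) (t + 1)
          (fun ω' => squint E T grid prior (fun s => g s ω') t) θ ω ≤
        Real.log (numRates E T * (∑ θ' ∈ grid, prior θ') / prior θ) := by
  have hb : ∀ᵐ ω ∂μ, ∀ t, ∀ θ ∈ grid, ∀ i ∈ Finset.Icc 1 (numRates E T),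
      |rate E i * linRegret g (t + 1) (fun ω' => squint E T grid prior (fun s => g s ω') t) θ ω| ≤
        2 / 5 :=
    ae_all_iff.2 fun t => (Finset.eventually_all _).2 fun θ hθ => (Finset.eventually_all _).2
      fun i hi => hG.abs_rate_mul_linRegret_le hG0 hE hGE
        (fun _ => predict_mem hE hN ⟨θ, hθ⟩ hprior convex_l1Ball hgrid _) (hgrid θ hθ)
        (Finset.mem_Icc.1 hi).1
  filter_upwards [hb] with ω hω θ hθ i hi
  simpa only [surrogate, linRegret, squintState_eq_sum] using
    rate_mul_squintState_le hE hN hprior (fun s => g s ω) T (fun t _ => hω t) hθ hi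

lemma sum_exp_neg_add_log_div {N x : ℝ} (hN : 0 < N) (hprior : ∀ θ ∈ grid, 0 < prior θ)
    (hne : grid.Nonempty) :
    ∑ θ ∈ grid, N * Real.exp (-(x + Real.log (N * (∑ θ' ∈ grid, prior θ') / prior θ))) =
      Real.exp (-x) := by
  have hsum := Finset.sum_pos hprior hne
  have hterm : ∀ θ ∈ grid,
      N * Real.exp (-(x + Real.log (N * (∑ θ' ∈ grid, prior θ') / prior θ))) =
        Real.exp (-x) / (∑ θ' ∈ grid, prior θ') * prior θ := by
    intro θ hθ
    have hθ' := hprior θ hθ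
    rw [neg_add, Real.exp_add, Real.exp_neg (Real.log _), Real.exp_log (by positivity)]
    field_simp
  rw [Finset.sum_congr rfl hterm, ← Finset.mul_sum, div_mul_cancel₀ _ hsum.ne']

lemma measure_iUnion_le_exp_neg {B : (Fin d → ℝ) → ℕ → Set Ω} {N : ℕ} (hN : 1 ≤ N)
    (hprior : ∀ θ ∈ grid, 0 < prior θ) (hne : grid.Nonempty) {x : ℝ}
    (hB : ∀ θ ∈ grid, ∀ i ∈ Finset.Icc 1 N, μ (B θ i) ≤ ENNReal.ofReal
      (Real.exp (-(x + Real.log (N * (∑ θ' ∈ grid, prior θ') / prior θ))))) :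
    μ (⋃ θ ∈ grid, ⋃ i ∈ Finset.Icc 1 N, B θ i) ≤ ENNReal.ofReal (Real.exp (-x)) := by
  refine (measure_biUnion_finset_le _ _).trans ?_
  rw [← sum_exp_neg_add_log_div (Nat.cast_pos.2 hN) hprior hne,
    ENNReal.ofReal_sum_of_nonneg fun _ _ => by positivity]
  refine Finset.sum_le_sum fun θ hθ => (measure_biUnion_finset_le _ _).trans ?_
  refine (Finset.sum_le_card_nsmul _ _ _ (hB θ hθ)).trans_eq ?_
  rw [Nat.card_Icc, Nat.add_sub_cancel, nsmul_eq_mul, ← ENNReal.ofReal_natCast,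
    ← ENNReal.ofReal_mul N.cast_nonneg]

lemma IsRandomConvexLoss.measure_compl_regretEvent_le [IsProbabilityMeasure μ]
    (h : IsRandomConvexLoss μ F ℓ g) (hG : LipschitzLoss μ g G) (hG0 : 0 ≤ G) (hE : 0 < E)
    (hGE : 5 * G ≤ Real.exp 1 * E) (hN : 1 ≤ numRates E T) (hprior : ∀ θ ∈ grid, 0 < prior θ)
    (hne : grid.Nonempty) (hgrid : ∀ θ ∈ grid, θ ∈ l1Ball d) (x : ℝ) :
    μ (regretEvent μ F g E (fun t ω => squint E T grid prior (fun s => g s ω) t) T grid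
      fun θ => x + 2 * Real.log (numRates E T * (∑ θ' ∈ grid, prior θ') / prior θ))ᶜ ≤
      ENNReal.ofReal (Real.exp (-x)) := by
  let p (t : ℕ) (ω : Ω) : Fin d → ℝ := squint E T grid prior (fun s => g s ω) t
  have hpb (t : ℕ) (ω : Ω) : p t ω ∈ l1Ball d :=
    predict_mem hE hN hne hprior convex_l1Ball hgrid _
  refine (measure_mono_ae ?_).trans (measure_iUnion_le_exp_neg hN hprior hne fun θ hθ i hi =>
    h.measure_condSurrogateSum_sub_ge_le (p := p) (η := rate E i) (θ := θ) h.measurable_squint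
      (fun t => ?_) T (x + Real.log (numRates E T * (∑ θ' ∈ grid, prior θ') / prior θ)))
  · filter_upwards [hG.rate_mul_sum_surrogate_le hG0 hE hGE hN hprior hgrid] with ω hω hωc
    by_contra hB
    refine hωc fun θ hθ i hi => ?_
    have htail : ω ∉ _ := fun hle =>
      hB (Set.mem_biUnion (Finset.mem_coe.2 hθ) (Set.mem_biUnion (Finset.mem_coe.2 hi) hle))
    rw [Set.mem_ofPred_eq, not_le] at htail
    linarith [hω θ hθ i hi]
  · filter_upwards [hG.abs_rate_mul_linRegret_le (t := t) hG0 hE hGE (hpb t) (hgrid θ hθ)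
      (Finset.mem_Icc.1 hi).1] with ω hω
    linarith

end Event

/-! ### The accelerable bound -/

section Acceleration

variable {d : ℕ} {Ω : Type*} {m : MeasurableSpace Ω} {μ : Measure Ω} [IsFiniteMeasure μ]
  {F : Filtration ℕ m} {ℓ : ℕ → Ω → (Fin d → ℝ) → ℝ} {g : ℕ → Ω → (Fin d → ℝ) → (Fin d → ℝ)}
  {G α β s ρ π : ℝ} {T : ℕ} {grid : Finset (Fin d → ℝ)} {p : ℕ → Ω → (Fin d → ℝ)}
  {θ k ξ : Fin d → ℝ}

lemma IsRandomConvexLoss.condRegret_le_of_mem_regretEvent (h : IsRandomConvexLoss μ F ℓ g)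
    (hG : LipschitzLoss μ g G) (hE : 1 ≤ 8 * G / 3) (hGT : Real.exp 1 ≤ G * T)
    (hp : ∀ t, Measurable[F t] (p t)) (hpb : ∀ t ω, p t ω ∈ l1Ball d)
    (hgrid : ∀ k ∈ grid, k ∈ l1Ball d) (hθ : θ ∈ l1Ball d)
    (hθ' : θ ∈ convexHull ℝ (grid : Set (Fin d → ℝ))) (hs : 0 < s) (hsT : 1 / 2 ≤ s ^ 2 * T) :
    ∀ᵐ ω ∂μ, ω ∈ regretEvent μ F g (8 * G / 3) p T grid (fun _ => 4 * s ^ 2 * T) →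
      condRegret μ F ℓ p T θ ω ≤ T * (68 * (G * s) + 32 * (G * s ^ 2)) := by
  have hG0 : 0 < G := by linarith
  obtain ⟨i, hi, hGi, hsi⟩ := exists_rate_mul_le_four_mul hE hGT hs hsT
  filter_upwards [h.condRegret_le_of_mem_convexHull hG hG0.le hp hpb hgrid hθ hθ'
    (rate_pos (by linarith : 0 < 8 * G / 3) i) T (4 * s ^ 2 * T)] with ω hω hev
  calc _ ≤ _ := hω fun k hk => hev k hk i hi
    _ = T * (4 * (s ^ 2 / rate (8 * G / 3) i) + 16 * G * (G * rate (8 * G / 3) i)) := by ring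
    _ ≤ T * (4 * (G * s + 8 * (G * s ^ 2)) + 16 * G * (4 * s)) := by gcongr
    _ = _ := by ring

lemma WeakExpConcave.condRegret_convexCombination_le_of_le_half (hw : WeakExpConcave μ F ℓ g α β)
    (h : IsRandomConvexLoss μ F ℓ g) (hG : LipschitzLoss μ g G) (hα : 0 < α) (hβ0 : 0 ≤ β)
    (hβ1 : β ≤ 1) (hE : 1 ≤ 8 * G / 3) (hGT : Real.exp 1 ≤ G * T)
    (hp : ∀ t, Measurable[F t] (p t)) (hpb : ∀ t ω, p t ω ∈ l1Ball d)
    (hgrid : ∀ k ∈ grid, k ∈ l1Ball d) (hk : k ∈ grid) (hξ : ξ ∈ l1Ball d)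
    (hξ' : ξ ∈ convexHull ℝ (grid : Set (Fin d → ℝ))) (hπ0 : 0 ≤ π) (hπ : π ≤ 1 / 2)
    (hs : 0 < s) (hsT : 1 / 2 ≤ s ^ 2 * T) (hρ : 0 < ρ) (hsρ : α * ρ ^ (1 - β) = s ^ 2 / ρ)
    (hbig : 4000 * (ρ + G * π * s + G * s ^ 2) < 2 * G) :
    ∀ᵐ ω ∂μ, ω ∈ regretEvent μ F g (8 * G / 3) p T grid (fun _ => 4 * s ^ 2 * T) →
      condRegret μ F ℓ p T ((1 - π) • k + π • ξ) ω ≤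
        T * (4000 * (ρ + G * π * s + G * s ^ 2)) := by
  have hG0 : 0 < G := by linarith
  obtain ⟨i, hi, hρi, hGi, hπi, hsi⟩ := exists_rate_le_of_mul_lt hE hGT hs hsT hρ.le hπ0 hbig
  obtain ⟨j, hj, hGj, hsj⟩ := exists_rate_mul_le_four_mul hE hGT hs hsT
  have hr (n : ℕ) : 0 < rate (8 * G / 3) n := rate_pos (by linarith) n
  have hbal : 4 * (32 * rate (8 * G / 3) i) ≤ α * ρ ^ (1 - β) := by
    rw [hsρ, le_div_iff₀ hρ]
    linarith
  have hball : (1 - π) • k + π • ξ ∈ l1Ball d :=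
    convex_l1Ball (hgrid k hk) hξ (by linarith) hπ0 (by ring)
  filter_upwards [h.condRegret_convexCombination_le hG hG0.le hp hpb hgrid hk hξ hξ' hπ0 hπ (hr i)
    (hr j) (fun t => hw.condExp_surrogateGap_nonneg h hG hG0.le hα hβ0 hβ1 hρ
      (by linarith [hr i]) hbal (by linarith) (hp t) (hpb t) hball) T (4 * s ^ 2 * T)]
    with ω hω hev
  calc _ ≤ _ := hω (hev k hk i hi) fun k' hk' => hev k' hk' j hj
    _ = T * (4 * ((1 - π) * (s ^ 2 / rate (8 * G / 3) i)) +
          4 * (π * (s ^ 2 / rate (8 * G / 3) j)) + 16 * (π * G * (G * rate (8 * G / 3) j)) +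
          128 * (π * G * (G * π * rate (8 * G / 3) i)) + ρ) := by ring
    _ ≤ T * (4 * (1 * (705 * (ρ + G * π * s + G * s ^ 2))) +
          4 * (π * (G * s + 8 * (G * s ^ 2))) + 16 * (π * G * (4 * s)) +
          128 * (π * G * (4 * s)) + ρ) := by
      gcongr
      · exact div_nonneg (sq_nonneg s) (hr i).le
      · linarith
    _ ≤ _ := by
      gcongr
      nlinarith [mul_nonneg (mul_nonneg hG0.le hπ0) hs.le, mul_pos hG0 (pow_pos hs 2)]

lemma WeakExpConcave.condRegret_convexCombination_le (hw : WeakExpConcave μ F ℓ g α β)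
    (h : IsRandomConvexLoss μ F ℓ g) (hG : LipschitzLoss μ g G) (hα : 0 < α) (hβ0 : 0 ≤ β)
    (hβ1 : β ≤ 1) (hE : 1 ≤ 8 * G / 3) (hGT : Real.exp 1 ≤ G * T)
    (hp : ∀ t, Measurable[F t] (p t)) (hpb : ∀ t ω, p t ω ∈ l1Ball d)
    (hgrid : ∀ k ∈ grid, k ∈ l1Ball d) (hhull : l1Ball d ⊆ convexHull ℝ (grid : Set (Fin d → ℝ)))
    (hk : k ∈ grid) (hξ : ξ ∈ l1Ball d) (hπ : π ∈ Set.Icc (0 : ℝ) 1)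
    (hs : 0 < s) (hsT : 1 / 2 ≤ s ^ 2 * T) (hρ : 0 < ρ) (hsρ : α * ρ ^ (1 - β) = s ^ 2 / ρ) :
    ∀ᵐ ω ∂μ, ω ∈ regretEvent μ F g (8 * G / 3) p T grid (fun _ => 4 * s ^ 2 * T) →
      condRegret μ F ℓ p T ((1 - π) • k + π • ξ) ω ≤
        T * (4000 * (ρ + G * π * s + G * s ^ 2)) := by
  have hG0 : 0 < G := by linarith
  have hball : (1 - π) • k + π • ξ ∈ l1Ball d :=
    convex_l1Ball (hgrid k hk) hξ (by linarith [hπ.2]) hπ.1 (by ring)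
  rcases le_or_gt (2 * G) (4000 * (ρ + G * π * s + G * s ^ 2)) with htriv | hbig
  · filter_upwards [h.condRegret_le_two_mul hG hG0.le hp hpb hball T] with ω hω _
    exact hω.trans (by gcongr)
  rcases le_or_gt π (1 / 2) with hhalf | hhalf
  · exact hw.condRegret_convexCombination_le_of_le_half h hG hα hβ0 hβ1 hE hGT hp hpb hgrid hk hξ
      (hhull hξ) hπ.1 hhalf hs hsT hρ hsρ hbig
  · filter_upwards [h.condRegret_le_of_mem_regretEvent hG hE hGT hp hpb hgrid hball (hhull hball)
      hs hsT] with ω hω hev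
    refine (hω hev).trans (mul_le_mul_of_nonneg_left ?_ T.cast_nonneg)
    nlinarith [mul_pos hG0 hs, mul_pos hG0 (pow_pos hs 2)]

end Acceleration

/-! ### Average risk -/

section AvgRisk

variable {d : ℕ} {Ω : Type*} {m : MeasurableSpace Ω} {μ : Measure Ω}
  {F : Filtration ℕ m} {ℓ : ℕ → Ω → (Fin d → ℝ) → ℝ} {L : ℕ → (Fin d → ℝ) → Ω → ℝ}

lemma IsCondRisk.continuousOn_avgRisk (hL : IsCondRisk μ F ℓ L) (p : ℕ → Ω → (Fin d → ℝ))
    (T : ℕ) : ∀ᵐ ω ∂μ, ContinuousOn (fun θ => avgRisk μ F ℓ p L T θ ω) (l1Ball d) := by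
  filter_upwards [hL.2] with ω hω
  exact continuousOn_const.sub (continuousOn_const.mul
    (continuousOn_finsetSum _ fun t ht => hω t (Finset.mem_Icc.1 ht).1))

variable {g : ℕ → Ω → (Fin d → ℝ) → (Fin d → ℝ)} {G α β s ρ : ℝ} {T : ℕ}
  {grid : Finset (Fin d → ℝ)} {p : ℕ → Ω → (Fin d → ℝ)} {θ : Fin d → ℝ}

lemma sum_Icc_one_eq_sum_range (f : ℕ → ℝ) (n : ℕ) :
    ∑ t ∈ Finset.Icc 1 n, f t = ∑ t ∈ Finset.range n, f (t + 1) := by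
  rw [Finset.range_eq_Ico, Finset.sum_Ico_add', zero_add, Finset.Ico_add_one_right_eq_Icc]

lemma IsCondRisk.avgRisk_ae_eq [IsFiniteMeasure μ] (hL : IsCondRisk μ F ℓ L)
    (h : IsRandomConvexLoss μ F ℓ g) (hG : LipschitzLoss μ g G) (hG0 : 0 ≤ G)
    (hp : ∀ t, Measurable[F t] (p t)) (hpb : ∀ t ω, p t ω ∈ l1Ball d) (T : ℕ)
    (hθ : θ ∈ l1Ball d) :
    avgRisk μ F ℓ p L T θ =ᵐ[μ] fun ω => condRegret μ F ℓ p T θ ω / T := by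
  have hsub (t : ℕ) := condExp_sub
    (h.integrable_comp hG hG0 ((hp t).mono (F.mono t.le_succ) le_rfl) (hpb t))
    (h.integrable (t + 1) (by omega) θ hθ) (F t)
  filter_upwards [ae_all_iff.2 hsub, ae_all_iff.2 fun t => hL.1 (t + 1) (by omega) θ hθ]
    with ω hsubω hLω
  have hterm (t : ℕ) : (μ[fun ω' => ℓ (t + 1) ω' (p t ω') - ℓ (t + 1) ω' θ | F t]) ω =
      (μ[fun ω' => ℓ (t + 1) ω' (p t ω') | F t]) ω - L (t + 1) θ ω :=
    (hsubω t).trans (congrArg (_ - ·) (hLω t).symm)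
  rw [condRegret, Finset.sum_congr rfl fun t _ => hterm t, Finset.sum_sub_distrib, avgRisk,
    ← mul_sub, one_div, ← div_eq_inv_mul, sum_Icc_one_eq_sum_range, sum_Icc_one_eq_sum_range]
  rfl

lemma WeakExpConcave.ae_avgRisk_le_of_mem_regretEvent [IsFiniteMeasure μ]
    (hw : WeakExpConcave μ F ℓ g α β) (h : IsRandomConvexLoss μ F ℓ g) (hG : LipschitzLoss μ g G)
    (hL : IsCondRisk μ F ℓ L) (hα : 0 < α) (hβ0 : 0 ≤ β) (hβ1 : β ≤ 1) (hE : 1 ≤ 8 * G / 3)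
    (hGT : Real.exp 1 ≤ G * T) (hp : ∀ t, Measurable[F t] (p t))
    (hpb : ∀ t ω, p t ω ∈ l1Ball d) (hgrid : ∀ k ∈ grid, k ∈ l1Ball d)
    (hhull : l1Ball d ⊆ convexHull ℝ (grid : Set (Fin d → ℝ))) (hne : grid.Nonempty)
    (hs : 0 < s) (hsT : 1 / 2 ≤ s ^ 2 * T) (hρ : 0 < ρ) (hsρ : α * ρ ^ (1 - β) = s ^ 2 / ρ) :
    ∀ᵐ ω ∂μ, ω ∈ regretEvent μ F g (8 * G / 3) p T grid (fun _ => 4 * s ^ 2 * T) →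
      ∀ θ ∈ l1Ball d, avgRisk μ F ℓ p L T θ ω ≤
        4000 * (ρ + G * gridAccel θ grid * s + G * s ^ 2) := by
  let q (k : Fin d → ℝ) (z : Set.Icc (0 : ℝ) 1 × l1Ball d) : Fin d → ℝ :=
    (1 - (z.1 : ℝ)) • k + (z.1 : ℝ) • (z.2 : Fin d → ℝ)
  have hq : ∀ k ∈ grid, ∀ z, q k z ∈ l1Ball d := fun k hk z =>
    convex_l1Ball (hgrid k hk) z.2.2 (by linarith [z.1.2.2]) z.1.2.1 (by ring)
  have hT := one_le_cast_of_exp_one_le_mul hGT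
  have hpoint : ∀ k ∈ grid, ∀ z, ∀ᵐ ω ∂μ,
      ω ∈ regretEvent μ F g (8 * G / 3) p T grid (fun _ => 4 * s ^ 2 * T) →
        avgRisk μ F ℓ p L T (q k z) ω ≤ 4000 * (ρ + G * (z.1 : ℝ) * s + G * s ^ 2) := by
    intro k hk z
    filter_upwards [hL.avgRisk_ae_eq h hG (by linarith) hp hpb T (hq k hk z),
      hw.condRegret_convexCombination_le h hG hα hβ0 hβ1 hE hGT hp hpb hgrid hhull hk z.2.2 z.1.2
        hs hsT hρ hsρ] with ω hω hle hev
    rw [hω, div_le_iff₀' (by linarith)]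
    exact hle hev
  have hunif := (Finset.eventually_all grid).2 fun k hk => ae_forall_le_of_forall_ae_le
    ((hL.continuousOn_avgRisk p T).mono fun ω hω =>
      hω.comp_continuous (f := q k) (by fun_prop) (hq k hk)) (by fun_prop) (hpoint k hk)
  filter_upwards [hunif] with ω hω hev θ hθ
  obtain ⟨hπ, k, hk, ξ, hξ, hθeq⟩ := exists_eq_gridAccel_combination hne hθ
  convert hω k hk hev (⟨gridAccel θ grid, hπ⟩, ⟨ξ, hξ⟩) using 2
  exact congrArg (avgRisk μ F ℓ p L T · ω) hθeq

end AvgRisk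

section UniformPrior

variable {d : ℕ} {Ω : Type*} {m : MeasurableSpace Ω} {μ : Measure Ω} [IsProbabilityMeasure μ]
  {F : Filtration ℕ m} {ℓ : ℕ → Ω → (Fin d → ℝ) → ℝ} {g : ℕ → Ω → (Fin d → ℝ) → (Fin d → ℝ)}
  {G x : ℝ} {T : ℕ} {grid : Finset (Fin d → ℝ)}

lemma IsRandomConvexLoss.measure_compl_regretEvent_uniformPrior_le
    (h : IsRandomConvexLoss μ F ℓ g) (hG : LipschitzLoss μ g G) (hE : 1 ≤ 8 * G / 3)
    (hGT : Real.exp 1 ≤ G * T) (hx : 0 < x) (hcard : 2 ≤ grid.card)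
    (hgrid : ∀ θ ∈ grid, θ ∈ l1Ball d) :
    μ (regretEvent μ F g (8 * G / 3)
      (fun t ω => squint (8 * G / 3) T grid (uniformPrior grid) (fun s => g s ω) t) T grid
      fun _ => 4 * complexityTerm grid G T x)ᶜ ≤ ENNReal.ofReal (Real.exp (-x)) := by
  have hne : grid.Nonempty := Finset.card_pos.1 (by omega)
  have hGE : 5 * G ≤ Real.exp 1 * (8 * G / 3) := by nlinarith [Real.exp_one_gt_d9]
  refine (measure_mono (Set.compl_subset_compl.2 (regretEvent_mono fun θ _ => ?_))).trans
    (h.measure_compl_regretEvent_le hG (by linarith) (by linarith) hGE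
      (one_le_numRates (by linarith [Real.exp_pos 1])) (fun θ _ => uniformPrior_pos hne θ) hne
      hgrid x)
  rw [sum_uniformPrior hne, mul_one, uniformPrior, div_inv_eq_mul]
  exact add_two_mul_log_le_complexityTerm hcard hx hGT

end UniformPrior

/-- There is a universal constant `C` such that the average risk of the algorithm, run on `grid`
with the uniform prior and `E = 8G/3`, satisfies the accelerable bound for all `θ` in the unit
`ℓ₁`-ball simultaneously, outside an event of probability at most `e^{-x}`. -/
theorem theorem2 :
    ∃ C : ℝ, 0 < C ∧
      ∀ (d : ℕ) (_ : 0 < d) (Ω : Type*) (m : MeasurableSpace Ω) (μ : Measure Ω)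
        (_ : IsProbabilityMeasure μ) (F : Filtration ℕ m)
        (ℓ : ℕ → Ω → (Fin d → ℝ) → ℝ) (g : ℕ → Ω → (Fin d → ℝ) → (Fin d → ℝ))
        (G α β x : ℝ) (T : ℕ) (grid : Finset (Fin d → ℝ)),
        IsRandomConvexLoss μ F ℓ g →
        LipschitzLoss μ g G →
        0 < α → 0 ≤ β → β ≤ 1 →
        WeakExpConcave μ F ℓ g α β →
        0 < x →
        1 ≤ 8 * G / 3 →
        Real.exp 1 ≤ G * T →
        (∀ θ ∈ grid, θ ∈ l1Ball d) →
        (∀ θ : Fin d → ℝ, l1norm θ = 1 → l0norm θ = 1 → θ ∈ grid) →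
        (∃ L : ℕ → (Fin d → ℝ) → Ω → ℝ, IsCondRisk μ F ℓ L) ∧
        ∀ L : ℕ → (Fin d → ℝ) → Ω → ℝ, IsCondRisk μ F ℓ L →
          μ {ω | ¬ ∀ θ ∈ l1Ball d,
              avgRisk μ F ℓ
                  (fun t ω' => squint (8 * G / 3) T grid (uniformPrior grid)
                    (fun s => g s ω') t) L T θ ω ≤
                C * ((complexityTerm grid G T x / (α * T)) ^ (1 / (2 - β)) +
                  G * gridAccel θ grid * Real.sqrt (complexityTerm grid G T x / T) +
                  complexityTerm grid G T x * G / T)} ≤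
            ENNReal.ofReal (Real.exp (-x)) := by
  refine ⟨4000, by norm_num, fun d hd Ω m μ _ F ℓ g G α β x T grid h hG hα hβ0 hβ1 hw hx hE hGT
    hgrid hcorners => ⟨h.exists_isCondRisk hG (by linarith), fun L hL => ?_⟩⟩
  set a := complexityTerm grid G T x
  have hcard := two_le_card_of_corners_mem hd hcorners
  have hne : grid.Nonempty := Finset.card_pos.1 (by omega)
  have ha : 1 / 2 ≤ a := half_le_complexityTerm hcard hx hGT
  have hT : (0 : ℝ) < T := by linarith [one_le_cast_of_exp_one_le_mul hGT]
  have haT : 0 < a / T := div_pos (by linarith) hT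
  have hs : √(a / T) ^ 2 = a / T := Real.sq_sqrt haT.le
  have hsT : √(a / T) ^ 2 * T = a := by rw [hs, div_mul_cancel₀ _ hT.ne']
  have hN := one_le_numRates (E := 8 * G / 3) (T := T) (by linarith [Real.exp_pos 1])
  have hbound := hw.ae_avgRisk_le_of_mem_regretEvent h hG hL hα hβ0 hβ1 hE hGT
    h.measurable_squint (fun t ω => predict_mem (by linarith) hN hne
      (fun θ _ => uniformPrior_pos hne θ) convex_l1Ball hgrid _) hgrid
    (l1Ball_subset_convexHull_of_corners_mem hd hcorners) hne (Real.sqrt_pos.2 haT)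
    (by rwa [hsT]) (Real.rpow_pos_of_pos (div_pos haT hα) _)
    ((mul_rpow_balance hα hβ1 haT).trans (by rw [hs]))
  refine (measure_mono_ae ?_).trans
    (h.measure_compl_regretEvent_uniformPrior_le hG hE hGT hx hcard hgrid)
  filter_upwards [hbound] with ω hω hviolated hev
  rw [mul_assoc 4, hsT, hs, div_div, mul_comm (T : ℝ), ← mul_div_assoc, mul_comm G a] at hω
  exact hviolated (hω hev)
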